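/- Let $d\ge 0$, $\mathcal T=(\mathbb R/2\pi\mathbb Z)^d$, $\Lambda^*=\mathbb Z^d$, $\mathcal B=\mathbb R^d$ (Euclidean norm), and let $\gamma,\delta>0$ with $\gamma+\delta<1$, $m\in\mathbb R$. *Symbols.* For sets $\mathcal S_\hbar\subset\mathcal T\times\mathcal B$, $\hbar\in(0,1]$, $\Psi_\delta^m(\mathcal S)$ is the set of families $P_\hbar\in C^\infty(\mathcal T\times\mathcal B,\mathbb C)$, $\hbar\in(0,1]$, such that for all multi-indices $\alpha,\beta\in\mathbb N^d$ there is $C>0$ with $|\partial_x^\alpha\partial_\xi^\beta P_\hbar(x,\xi)|\le C\hbar^{m-\delta|\beta|}$ for all $\hbar\in(0,1]$ and $(x,\xi)\in\mathcal S_\hbar$; $\Psi_\delta^m=\Psi_\delta^m(\mathcal T\times\mathcal B)$ and $\Psi_\delta^\infty(\mathcal S)=\bigcap_{M\in\mathbb R}\Psi_\delta^M(\mathcal S)$. Write $\tilde f(k,\xi)=(2\pi)^{-d}\int_{\mathcal T}e^{-ik\cdot x}f(x,\xi)\,dx$. The adjoint of a symbol $P_\hbar$ is $$P_\hbar^*(x,\xi)=\sum_{k\in\Lambda^*}\frac1{(2\pi)^d}\int_{\mathcal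 T}e^{ik\cdot(x-y)}\,\overline{P_\hbar(y,\xi+\hbar k)}\,dy ,$$ and $P_\hbar$ is self-adjoint if $P_\hbar^*=P_\hbar$ for all $\hbar\in(0,1]$. *Resonances.* Let $H:\mathcal B\to\mathbb R$ be smooth with all derivatives (of every order $\ge0$) bounded, and $\Omega_X(\xi)=dH_\xi(X)$ for $X\in\mathbb R^d$. A sublattice (subgroup) $\mathcal R\subset\Lambda^*$ of rank $n$ is an $\hbar^{-\gamma}$-lattice if it has a $\mathbb Z$-basis of vectors of norm $\le\hbar^{-\gamma}$ ($\mathcal R=0$ is allowed). Let $\mathrm{vol}(\mathcal R)$ be the volume of a fundamental domain of $\mathcal R$ in its real span $\mathbb R.\mathcal R$, and put $$\Sigma_{\mathcal R}=\{\xi:\Omega_k(\xi)=0\ \forall k\in\mathcal R\},\qquad \mathcal Z_{\mathcal R}=\Big\{\xi:\frac{|\Omega_X(\xi)|}{|X|}<\frac{2^n\hbar^{\delta-\gamma n}}{\mathrm{vol}(\mathcal R)}\ \ \forall X\in\mathbb R.\mathcal R\setminus\{0\}\Big\},$$ $\mathcal B_{\mathcal R}=\mathcal Z_{\mathcal R}\setminus\bigcup_{\mathcal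 R'}\mathcal Z_{\mathcal R'}$, the union being over all $\hbar^{-\gamma}$-lattices $\mathcal R'$ of rank $n+1$. The $\mathcal R$-average of $f$ is $$\mathcal R\text{-av}(f)(x,\xi)=\int_{[0,1]^{d-n}}f(x+t_1X_1+\dots+t_{d-n}X_{d-n},\xi)\,dt,$$ where $(X_j)$ is any basis of $\mathcal R^\circ=\{X\in2\pi\mathbb Z^d: k\cdot X=0\ \forall k\in\mathcal R\}$. *The $\hbar^\delta$-average.* Fix an even $\chi\in C^\infty(\mathbb R,[0,1])$ vanishing for $|t|\ge1$ and such that $\chi-1$ vanishes at $t=0$ together with all its derivatives. The $\hbar^\delta$-average $A_\hbar$ of $K_\hbar\in\Psi_\delta^m$ is the function with Fourier coefficients $\tilde A_\hbar(k,\xi)=\chi\big(\tfrac{\Omega_k(\xi)}{|k|\hbar^\delta}\big)\tilde K_\hbar(k,\xi)$ for $k\ne0$ and $\tilde A_\hbar(0,\xi)=\tilde K_\hbar(0,\xi)$. **Proposition.** Let $K_\hbar\in\Psi_\delta^m$ be self-adjoint and let $A_\hbar$ be its $\hbar^\delta$-average. Let $B_\hbar$ be either $A_\hbar^*$ or $\tfrac12(A_\hbar+A_\hbar^*)$.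 Then $B_\hbar\in\Psi_\delta^m$, and for every family $(\mathcal R_\hbar)_{\hbar\in(0,1]}$ such that each $\mathcal R_\hbar$ is an $\hbar^{-\gamma}$-lattice, $$B_\hbar-\mathcal R_\hbar\text{-av}(K_\hbar)\in\Psi_\delta^\infty\big(\mathcal T\times(\Sigma_{\mathcal R_\hbar}\cap\mathcal B_{\mathcal R_\hbar})\big)\quad\text{and}\quad B_\hbar-\mathcal R_\hbar\text{-av}(B_\hbar)\in\Psi_\delta^\infty\big(\mathcal T\times\mathcal B_{\mathcal R_\hbar}\big).$$ -/

import Mathlib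

open scoped ContDiff

noncomputable section

namespace TorusPDO

/-- Momentum space `ℝ^d` with its Euclidean norm. -/
abbrev Momentum (d : ℕ) : Type := EuclideanSpace ℝ (Fin d)

/-- An `ħ`-family of functions `P ħ x ξ` on the cotangent bundle of the torus `(ℝ/2πℤ)^d`. The
position is lifted to `x ∈ ℝ^d`; `2π`-periodicity is required in `IsPeriodic` below. -/
abbrev Family (d : ℕ) : Type := ℝ → (Fin d → ℝ) → Momentum d → ℂ

/-- The Fourier lattice `ℤ^d`. -/
abbrev FourierLattice (d : ℕ) : Type := Fin d → ℤ

variable {d : ℕ}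

/-- A Fourier variable `k ∈ ℤ^d` seen as a vector of the Euclidean space `ℝ^d`. -/
def toVec (k : FourierLattice d) : Momentum d := WithLp.toLp 2 fun i => (k i : ℝ)

/-- The pairing `k · x`. -/
def pairing (k : FourierLattice d) (x : Fin d → ℝ) : ℝ := ∑ i, (k i : ℝ) * x i

/-- The character `e^{i k · x}`. -/
def expChar (k : FourierLattice d) (x : Fin d → ℝ) : ℂ :=
  Complex.exp (Complex.I * (pairing k x : ℂ))

/-! ### Classes of symbols -/

/-- `f` is `2πℤ^d`-periodic in `x`, that is, a function on `(ℝ/2πℤ)^d × ℝ^d`. -/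
def IsPeriodic (f : (Fin d → ℝ) → Momentum d → ℂ) : Prop :=
  ∀ (n : FourierLattice d) (x : Fin d → ℝ) (ξ : Momentum d),
    f (fun i => x i + 2 * Real.pi * (n i : ℝ)) ξ = f x ξ

/-- `P` belongs to the class `Ψ_δ^m(S)`: each `P ħ`, `0 < ħ ≤ 1`, is a smooth function on the
cotangent bundle of the torus, and for all orders `a = |α|`, `b = |β|` the mixed derivatives
`∂_x^α ∂_ξ^β P` are bounded by `C ħ^(m - δ b)` on `S`, uniformly in `ħ`. All partial derivatives
of orders `a` in `x` and `b` in `ξ` are bounded at once through the norm of the iterated Fréchet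
derivative (the choice of norms only affects `C`). The region `S` may depend on `ħ`. -/
def IsSymbol (m δ : ℝ) (S : ℝ → Set ((Fin d → ℝ) × Momentum d)) (P : Family d) : Prop :=
  (∀ ħ ∈ Set.Ioc (0 : ℝ) 1,
    ContDiff ℝ ∞ (fun z : (Fin d → ℝ) × Momentum d => P ħ z.1 z.2) ∧ IsPeriodic (P ħ)) ∧
  ∀ a b : ℕ, ∃ C : ℝ, 0 < C ∧ ∀ ħ ∈ Set.Ioc (0 : ℝ) 1, ∀ x ξ, (x, ξ) ∈ S ħ →
    ‖iteratedFDeriv ℝ a (fun y => iteratedFDeriv ℝ b (fun η => P ħ y η) ξ) x‖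
      ≤ C * ħ ^ (m - δ * (b : ℝ))

/-- The class `Ψ_δ^m` on the whole cotangent bundle. -/
def IsGlobalSymbol (m δ : ℝ) (P : Family d) : Prop := IsSymbol m δ (fun _ => Set.univ) P

/-- The class `Ψ_δ^∞(S)`, the intersection of all `Ψ_δ^M(S)`. -/
def IsNegligibleOn (δ : ℝ) (S : ℝ → Set ((Fin d → ℝ) × Momentum d)) (P : Family d) : Prop :=
  ∀ M : ℝ, IsSymbol M δ S P

/-! ### Fourier series and adjoints -/

/-- The Fourier coefficient in `x`: `(2π)^{-d} ∫_{[0,2π]^d} e^{-i k · x} f(x, ξ) dx`. -/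
def fourierCoeffX (f : (Fin d → ℝ) → Momentum d → ℂ) (k : FourierLattice d)
    (ξ : Momentum d) : ℂ :=
  (((2 * Real.pi) ^ d)⁻¹ : ℝ) *
    ∫ x in Set.Icc (0 : Fin d → ℝ) (fun _ => 2 * Real.pi), expChar (-k) x * f x ξ

/-- The adjoint symbol
`P*(x, ξ) = ∑_k (2π)^{-d} ∫ e^{i k · (x - y)} conj P(y, ξ + ħ k) dy`. -/
def adjointSymbol (P : Family d) : Family d := fun ħ x ξ =>
  ∑' k : FourierLattice d, (((2 * Real.pi) ^ d)⁻¹ : ℝ) *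
    ∫ y in Set.Icc (0 : Fin d → ℝ) (fun _ => 2 * Real.pi),
      expChar k (x - y) * (starRingEnd ℂ) (P ħ y (ξ + ħ • toVec k))

/-- A symbol is self-adjoint if it equals its adjoint symbol. -/
def IsSelfAdjointSymbol (P : Family d) : Prop :=
  ∀ ħ ∈ Set.Ioc (0 : ℝ) 1, ∀ x ξ, adjointSymbol P ħ x ξ = P ħ x ξ

/-- The self-adjoint part `½ (P + P*)`. -/
def selfAdjointPart (P : Family d) : Family d := fun ħ x ξ =>
  (1 / 2 : ℂ) * (P ħ x ξ + adjointSymbol P ħ x ξ)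

/-! ### Geometry of resonances -/

/-- `Ω_X(ξ) = dH_ξ(X)`. -/
def Omega (H : Momentum d → ℝ) (X ξ : Momentum d) : ℝ := fderiv ℝ H ξ X

/-- Sublattices of the Fourier lattice; the dimension of `R` is `Module.finrank ℤ R`. -/
abbrev Sublattice (d : ℕ) : Type := Submodule ℤ (FourierLattice d)

/-- `R` is a resonance `ħ^{-γ}`-lattice: it has a basis of vectors of norm at most `ħ^{-γ}`. -/
def IsResonanceLattice (γ ħ : ℝ) (R : Sublattice d) : Prop :=
  ∃ (n : ℕ) (e : Module.Basis (Fin n) ℤ R),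
    ∀ j, ‖toVec (e j : FourierLattice d)‖ ≤ ħ ^ (-γ)

/-- The volume of a fundamental domain of `R` (in the real span of `R`): the volume
`√det(⟨e_i, e_j⟩)` of the parallelepiped spanned by a basis of `R`. It does not depend on the
basis. -/
def latticeVol (R : Sublattice d) : ℝ :=
  Real.sqrt (Matrix.det (Matrix.of fun i j : Fin (Module.finrank ℤ R) =>
    inner ℝ (toVec (Module.finBasis ℤ R i : FourierLattice d))
      (toVec (Module.finBasis ℤ R j : FourierLattice d))))

/-- The real span `ℝ.R`. -/
def realSpan (R : Sublattice d) : Submodule ℝ (Momentum d) :=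
  Submodule.span ℝ (toVec '' (R : Set (FourierLattice d)))

/-- The resonance manifold `Σ_R`; it is the whole momentum space for `R = 0`. -/
def resonanceManifold (H : Momentum d → ℝ) (R : Sublattice d) : Set (Momentum d) :=
  {ξ | ∀ k ∈ R, Omega H (toVec k) ξ = 0}

/-- The resonance zone `Z_R`; it is the whole momentum space for `R = 0`. -/
def resonanceZone (H : Momentum d → ℝ) (γ δ ħ : ℝ) (R : Sublattice d) : Set (Momentum d) :=
  {ξ | ∀ X ∈ realSpan R, X ≠ 0 → |Omega H X ξ| / ‖X‖ <
    2 ^ Module.finrank ℤ R * ħ ^ (δ - γ * (Module.finrank ℤ R : ℝ)) / latticeVol R}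

/-- The zone `Z*_n` of `n`-resonances, the union of the zones of all `n`-dimensional resonance
`ħ^{-γ}`-lattices (empty for `n = d + 1`). -/
def zoneOfOrder (H : Momentum d → ℝ) (γ δ ħ : ℝ) (n : ℕ) : Set (Momentum d) :=
  {ξ | ∃ R : Sublattice d, IsResonanceLattice γ ħ R ∧ Module.finrank ℤ R = n ∧
    ξ ∈ resonanceZone H γ δ ħ R}

/-- The resonance block `B_R = Z_R \ Z*_{n+1}`, where `n = dim R`. -/
def resonanceBlock (H : Momentum d → ℝ) (γ δ ħ : ℝ) (R : Sublattice d) : Set (Momentum d) :=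
  resonanceZone H γ δ ħ R \ zoneOfOrder H γ δ ħ (Module.finrank ℤ R + 1)

/-! ### Averaging -/

/-- The lattice of all `n ∈ ℤ^d` with `k · n = 0` for all `k ∈ R`. The dual `R°` of `R` in
`2πℤ^d` consists of the vectors `2π n`. -/
def annihilatorLattice (R : Sublattice d) : Sublattice d where
  carrier := {n | ∀ k ∈ R, ∑ i, k i * n i = 0}
  add_mem' := by
    intro a b ha hb k hk
    simp only [Pi.add_apply, mul_add, Finset.sum_add_distrib, ha k hk, hb k hk, add_zero]
  zero_mem' := by
    intro k _
    simp
  smul_mem' := by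
    intro c a ha k hk
    have h : ∑ i, k i * (c • a) i = c * ∑ i, k i * a i := by
      rw [Finset.mul_sum]
      refine Finset.sum_congr rfl fun i _ => ?_
      simp only [Pi.smul_apply, smul_eq_mul]
      ring
    rw [h, ha k hk, mul_zero]

/-- The `R`-average `∫_{[0,1]^p} f(x + t_1 X_1 + ... + t_p X_p, ξ) dt`, where `X_1, ..., X_p` is a
basis of `R° ⊂ 2πℤ^d`. For `2πℤ^d`-periodic `f` it does not depend on the basis. -/
def latticeAverage (R : Sublattice d) (f : (Fin d → ℝ) → Momentum d → ℂ) :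
    (Fin d → ℝ) → Momentum d → ℂ := fun x ξ =>
  ∫ t in Set.Icc (0 : Fin (Module.finrank ℤ (annihilatorLattice R)) → ℝ) 1,
    f (fun i => x i + ∑ j, t j * (2 * Real.pi *
      (((Module.finBasis ℤ (annihilatorLattice R) j : FourierLattice d) i : ℤ) : ℝ))) ξ

/-- The truncation functions: smooth, even, with values in `[0,1]`, vanishing for `|t| ≥ 1`, and
such that `χ - 1` is flat at `0`. -/
structure IsTruncation (χ : ℝ → ℝ) : Prop where
  smooth : ContDiff ℝ ∞ χ
  mem_Icc : ∀ t, χ t ∈ Set.Icc (0 : ℝ) 1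
  even : ∀ t, χ (-t) = χ t
  vanish : ∀ t, 1 ≤ |t| → χ t = 0
  flat : ∀ n : ℕ, iteratedDeriv n (fun t => χ t - 1) 0 = 0

/-- The `ħ^δ`-average of `K`: the function with Fourier coefficients
`χ(Ω_k(ξ) / (|k| ħ^δ)) K̃(k, ξ)` for `k ≠ 0`, and `K̃(0, ξ)` for `k = 0`. -/
def quasiAverage (H : Momentum d → ℝ) (χ : ℝ → ℝ) (δ : ℝ) (K : Family d) : Family d :=
  fun ħ x ξ => ∑' k : FourierLattice d,
    (if k = 0 then 1 else ((χ (Omega H (toVec k) ξ / (‖toVec k‖ * ħ ^ δ)) : ℝ) : ℂ)) *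
      fourierCoeffX (K ħ) k ξ * expChar k x

/-- The quasi-resonant averaging properties of `A` with respect to `K`: `A` is in the class
`Ψ_δ^m`, and for every family `R_ħ` of resonance `ħ^{-γ}`-lattices, `A - R-av(K)` is in
`Ψ_δ^∞` over `Σ_R ∩ B_R`, and `A - R-av(A)` is in `Ψ_δ^∞` over `B_R`. -/
def HasAveragingProperties (H : Momentum d → ℝ) (γ δ m : ℝ) (K A : Family d) : Prop :=
  IsGlobalSymbol m δ A ∧
  ∀ R : ℝ → Sublattice d, (∀ ħ ∈ Set.Ioc (0 : ℝ) 1, IsResonanceLattice γ ħ (R ħ)) →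
    IsNegligibleOn δ
      (fun ħ => Set.univ ×ˢ (resonanceManifold H (R ħ) ∩ resonanceBlock H γ δ ħ (R ħ)))
      (fun ħ x ξ => A ħ x ξ - latticeAverage (R ħ) (K ħ) x ξ) ∧
    IsNegligibleOn δ
      (fun ħ => Set.univ ×ˢ resonanceBlock H γ δ ħ (R ħ))
      (fun ħ x ξ => A ħ x ξ - latticeAverage (R ħ) (A ħ) x ξ)

end TorusPDO

end

open scoped ContDiff
noncomputable section
namespace TorusPDO

open MeasureTheory Set

/-! Every object in the statement is obtained from $K$ by multiplying its Fourier coefficients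
$\tilde K(k,\xi)$ by some $c_k(\xi)$, so the theorem becomes a family of estimates on multipliers.
For $A$ the multiplier is $\chi(\Omega_k(\xi)/(|k|\hbar^\delta))$. Self-adjointness of $K$ reads
$\overline{\tilde K(-k,\xi+\hbar k)}=\tilde K(k,\xi)$, so, $\chi$ being even, $A^*$ has the same
multiplier with $\Omega_k$ evaluated at $\xi+\hbar k$. The parameter `s` of `cutoff` treats both at
once ($s=0$ for $A$, $s=1$ for $A^*$). The $\mathcal R$-average has as multiplier the indicator
function of the saturation $\mathbb R.\mathcal R\cap\mathbb Z^d$.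

Since $\tilde K(k,\xi)$ decays faster than any power of $1+|k|$, a multiplier may grow polynomially
in $k$; what matters is the power of $\hbar$ (`IsMultiplier.isSymbol`). Two estimates then suffice.

Outside the saturation, over $\mathcal B_{\mathcal R}$: if $|k|\le\hbar^{-\gamma}$, then $\mathcal
R+\mathbb Zk$ is an $\hbar^{-\gamma}$-lattice of rank $n+1$ whose zone $\xi$ avoids. Comparing the
two zones, with $\mathrm{vol}(\mathcal R+\mathbb Zk)=|u|\,\mathrm{vol}(\mathcal R)$ for $u$ the
component of $k$ orthogonal to $\mathcal R$ and Hadamard's inequality for $\mathrm{vol}(\mathcal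
R)$, gives $|\Omega_k(\xi)|\ge 2|k|\hbar^\delta$ (`le_abs_Omega_of_mem_resonanceBlock`). The shift
by $s\hbar k$ moves the argument of $\chi$ by $O(|k|\hbar^{1-\delta})$. So either that argument
exceeds $1$ in absolute value, and $\chi$ vanishes to infinite order, or $1+|k|$ is at least a
constant times a negative power of $\hbar$, and polynomial growth in $k$ buys any power of $\hbar$.

Inside the saturation, over $\Sigma_{\mathcal R}$: $\Omega_k(\xi)=0$, so the argument is
$O(|k|\hbar^{1-\delta})$, and flatness of $\chi-1$ at $0$ makes $\chi-1$ negligible. For $B-\mathcal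
R\text{-av}(B)$ the multiplier is zero inside the saturation, which is why $\Sigma_{\mathcal R}$
plays no role there. -/

/-! ### Integrals of periodic functions over a period cube. -/

/-- The basis of `ℝ^p` consisting of the multiples by `L` of the standard basis vectors. -/
def scaledBasis (p : ℕ) {L : ℝ} (hL : 0 < L) : Module.Basis (Fin p) ℝ (Fin p → ℝ) :=
  (Pi.basisFun ℝ (Fin p)).unitsSMul fun _ => Units.mk0 L hL.ne'

lemma scaledBasis_apply (p : ℕ) {L : ℝ} (hL : 0 < L) (i : Fin p) :
    scaledBasis p hL i = Pi.single i L := by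
  ext j
  simp [scaledBasis, Module.Basis.unitsSMul_apply, Units.smul_def, Pi.single_apply]

lemma scaledBasis_repr (p : ℕ) {L : ℝ} (hL : 0 < L) (x : Fin p → ℝ) (i : Fin p) :
    (scaledBasis p hL).repr x i = L⁻¹ * x i := by
  simp [scaledBasis, Module.Basis.repr_unitsSMul, Units.smul_def]

lemma fundamentalDomain_scaledBasis (p : ℕ) {L : ℝ} (hL : 0 < L) :
    ZSpan.fundamentalDomain (scaledBasis p hL) = Set.pi univ fun _ => Ico 0 L := by
  ext x
  simp only [ZSpan.mem_fundamentalDomain, scaledBasis_repr, mem_pi, mem_univ, true_implies]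
  refine forall_congr' fun i => ?_
  simp only [mem_Ico]
  rw [inv_mul_lt_iff₀ hL, mul_one, mul_nonneg_iff_of_pos_left (inv_pos.2 hL)]

lemma mem_span_scaledBasis (p : ℕ) {L : ℝ} (hL : 0 < L)
    (g : Submodule.span ℤ (range (scaledBasis p hL))) :
    ∃ n : Fin p → ℤ, (g : Fin p → ℝ) = fun i => L * (n i : ℝ) := by
  obtain ⟨g, hg⟩ := g
  obtain ⟨n, hn⟩ := (Submodule.mem_span_range_iff_exists_fun ℤ).1 hg
  refine ⟨n, ?_⟩
  simp only [← hn]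
  ext i
  simp [scaledBasis_apply, Pi.single_apply, mul_comm]

open scoped Pointwise in
/-- The integral of a periodic function over a period cube is invariant under translations. -/
lemma setIntegral_cube_add {p : ℕ} {F : Type*} [NormedAddCommGroup F] [NormedSpace ℝ F]
    {L : ℝ} (hL : 0 < L) (f : (Fin p → ℝ) → F)
    (hf : ∀ (n : Fin p → ℤ) (x : Fin p → ℝ), f (fun i => x i + L * (n i : ℝ)) = f x)
    (h : Fin p → ℝ) :
    ∫ x in Icc (0 : Fin p → ℝ) (fun _ => L), f (x + h) =
      ∫ x in Icc (0 : Fin p → ℝ) (fun _ => L), f x := by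
  have hae : (Set.pi univ fun _ => Ico 0 L : Set (Fin p → ℝ)) =ᵐ[volume]
      Icc (0 : Fin p → ℝ) (fun _ => L) := Measure.univ_pi_Ico_ae_eq_Icc
  rw [← setIntegral_congr_set hae, ← setIntegral_congr_set hae,
    ← fundamentalDomain_scaledBasis p hL]
  have hD := ZSpan.isAddFundamentalDomain (scaledBasis p hL) (volume : Measure (Fin p → ℝ))
  set D := ZSpan.fundamentalDomain (scaledBasis p hL)
  -- The half-open cube and its translate are both fundamental domains of $L\mathbb Z^p$, so an
  -- invariant function has the same integral over the two.
  have hT := hD.vadd_of_comm h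
  have hinv : ∀ (g : Submodule.span ℤ (range (scaledBasis p hL))) (x : Fin p → ℝ),
      f (g +ᵥ x) = f x := by
    intro g x
    obtain ⟨n, hn⟩ := mem_span_scaledBasis p hL g
    rw [Submodule.vadd_def, vadd_eq_add, hn, ← hf n x, add_comm]
    rfl
  have : VAddInvariantMeasure (Submodule.span ℤ (range (scaledBasis p hL))) (Fin p → ℝ)
      volume := ⟨fun c s _ => measure_preimage_add volume (c : Fin p → ℝ) s⟩
  rw [hD.setIntegral_eq hT hinv, ← (measurePreserving_add_right volume h).setIntegral_preimage_emb
    (measurableEmbedding_addRight h) f (h +ᵥ D)]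
  congr 2
  ext x
  simp [Set.mem_vadd_set, add_comm]

variable {d : ℕ}

/-! ### Characters -/

lemma pairing_add (k : FourierLattice d) (x y : Fin d → ℝ) :
    pairing k (x + y) = pairing k x + pairing k y := by
  simp [pairing, mul_add, Finset.sum_add_distrib]

lemma pairing_neg (k : FourierLattice d) (x : Fin d → ℝ) : pairing (-k) x = -pairing k x := by
  simp [pairing]

lemma pairing_add_left (k l : FourierLattice d) (x : Fin d → ℝ) :
    pairing (k + l) x = pairing k x + pairing l x := by
  simp [pairing, add_mul, Finset.sum_add_distrib]

lemma expChar_add (k : FourierLattice d) (x y : Fin d → ℝ) :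
    expChar k (x + y) = expChar k x * expChar k y := by
  simp [expChar, pairing_add, mul_add, Complex.exp_add]

lemma expChar_add_left (k l : FourierLattice d) (x : Fin d → ℝ) :
    expChar (k + l) x = expChar k x * expChar l x := by
  simp [expChar, pairing_add_left, mul_add, Complex.exp_add]

lemma expChar_zero_left (x : Fin d → ℝ) : expChar 0 x = 1 := by
  simp [expChar, pairing]

lemma norm_expChar (k : FourierLattice d) (x : Fin d → ℝ) : ‖expChar k x‖ = 1 := by
  rw [expChar, mul_comm, Complex.norm_exp_ofReal_mul_I]

lemma expChar_neg_left (k : FourierLattice d) (x : Fin d → ℝ) :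
    expChar (-k) x = (starRingEnd ℂ) (expChar k x) := by
  rw [expChar, expChar, ← Complex.exp_conj, pairing_neg]
  simp

lemma expChar_sub (k : FourierLattice d) (x y : Fin d → ℝ) :
    expChar k (x - y) = expChar k x * expChar (-k) y := by
  have : pairing k (x - y) = pairing k x + pairing (-k) y := by
    rw [sub_eq_add_neg, pairing_add, pairing_neg]
    simp [pairing]
  simp [expChar, this, mul_add, Complex.exp_add]

lemma expChar_periodic (k n : FourierLattice d) (x : Fin d → ℝ) :
    expChar k (fun i => x i + 2 * Real.pi * (n i : ℝ)) = expChar k x := by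
  have h : pairing k (fun i => x i + 2 * Real.pi * (n i : ℝ)) =
      pairing k x + 2 * Real.pi * ((∑ i, k i * n i : ℤ) : ℝ) := by
    simp only [pairing, mul_add, Finset.sum_add_distrib, Int.cast_sum, Int.cast_mul,
      Finset.mul_sum]
    congr 1
    exact Finset.sum_congr rfl fun i _ => by ring
  rw [expChar, expChar, h, Complex.exp_eq_exp_iff_exists_int]
  exact ⟨∑ i, k i * n i, by push_cast; ring⟩

/-- The pairing with `k` as a continuous linear form. -/
def pairingCLM (k : FourierLattice d) : (Fin d → ℝ) →L[ℝ] ℝ :=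
  ∑ i, (k i : ℝ) • ContinuousLinearMap.proj i

lemma pairingCLM_apply (k : FourierLattice d) (x : Fin d → ℝ) :
    pairingCLM k x = pairing k x := by
  simp [pairingCLM, pairing]

lemma expChar_eq (k : FourierLattice d) :
    expChar k = (fun t : ℝ => Complex.exp ((t : ℂ) * Complex.I)) ∘ pairingCLM k := by
  ext x
  simp [expChar, pairingCLM_apply, mul_comm]

lemma contDiff_expChar (k : FourierLattice d) {n : WithTop ℕ∞} : ContDiff ℝ n (expChar k) := by
  rw [expChar_eq]
  exact ((Complex.ofRealCLM.contDiff.mul contDiff_const).cexp).comp (pairingCLM k).contDiff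

lemma continuous_expChar (k : FourierLattice d) : Continuous (expChar k) :=
  (contDiff_expChar k (n := 0)).continuous

/-- The translation by half a period of `e^{i k · x}` in the direction of a nonzero `k j`. -/
def halfShift (k : FourierLattice d) (j : Fin d) : Fin d → ℝ := Pi.single j (Real.pi / (k j : ℝ))

lemma expChar_halfShift {k : FourierLattice d} {j : Fin d} (hj : k j ≠ 0) :
    expChar k (halfShift k j) = -1 := by
  have h : pairing k (halfShift k j) = Real.pi := by
    have hj' : (k j : ℝ) ≠ 0 := by exact_mod_cast hj
    simp only [pairing, halfShift, Pi.single_apply, mul_ite, mul_zero, Finset.sum_ite_eq',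
      Finset.mem_univ, if_true]
    field_simp
  rw [expChar, h, mul_comm, Complex.exp_pi_mul_I]

lemma norm_halfShift (k : FourierLattice d) (j : Fin d) :
    ‖halfShift k j‖ = Real.pi / |(k j : ℝ)| := by
  rw [halfShift, Pi.norm_single, Real.norm_eq_abs, abs_div, abs_of_pos Real.pi_pos]

/-- The period cube of the torus. -/
abbrev cube (d : ℕ) : Set (Fin d → ℝ) := Icc (0 : Fin d → ℝ) (fun _ => 2 * Real.pi)

lemma volume_cube : volume.real (cube d) = (2 * Real.pi) ^ d := by
  rw [Measure.real, Real.volume_Icc_pi_toReal (by intro i; simp; positivity)]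
  simp

lemma volume_cube_lt_top : volume (cube d) < ⊤ := isCompact_Icc.measure_lt_top

/-! ### Decay of Fourier coefficients by half-period translations. -/

section FourierDecay

variable {F : Type*} [NormedAddCommGroup F] [NormedSpace ℝ F] [NormedSpace ℂ F]

/-- Translation by half a period reverses the sign of the character and preserves the integral over
the cube. The oscillation thus replaces $G$ by a difference, and no integration by parts is needed.
-/
lemma two_smul_integral_expChar_smul {k : FourierLattice d} {j : Fin d} (hj : k j ≠ 0)
    {G : (Fin d → ℝ) → F} (hG : Continuous G)
    (hper : ∀ (n : FourierLattice d) x, G (fun i => x i + 2 * Real.pi * (n i : ℝ)) = G x) :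
    (2 : ℝ) • ∫ x in cube d, expChar k x • G x =
      ∫ x in cube d, expChar k x • (G x - G (x + halfShift k j)) := by
  have h := setIntegral_cube_add Real.two_pi_pos (fun x => expChar k x • G x)
    (fun n x => by simp only [expChar_periodic, hper]) (halfShift k j)
  simp only [expChar_add, expChar_halfShift hj] at h
  simp only [smul_sub]
  rw [integral_sub, two_smul]
  · nth_rewrite 2 [← h]
    simp [integral_neg, sub_eq_add_neg]
  · exact (((continuous_expChar k).smul hG).continuousOn).integrableOn_compact isCompact_Icc
  · exact (((continuous_expChar k).smul
      (hG.comp (continuous_id.add continuous_const))).continuousOn).integrableOn_compact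
      isCompact_Icc

/-- Decay of the Fourier coefficients of a smooth periodic function. -/
lemma norm_integral_expChar_smul_le {k : FourierLattice d} {j : Fin d} (hj : k j ≠ 0) (N : ℕ) :
    ∀ {G : (Fin d → ℝ) → F}, ContDiff ℝ ∞ G →
    (∀ (n : FourierLattice d) x, G (fun i => x i + 2 * Real.pi * (n i : ℝ)) = G x) →
    ∀ {C : ℝ}, (∀ x, ‖iteratedFDeriv ℝ N G x‖ ≤ C) →
    ‖∫ x in cube d, expChar k x • G x‖ ≤
      (Real.pi / (2 * |(k j : ℝ)|)) ^ N * C * (2 * Real.pi) ^ d := by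
  induction N with
  | zero =>
    intro G _ _ C hC
    have := norm_setIntegral_le_of_norm_le_const (μ := volume) (s := cube d)
      (f := fun x => expChar k x • G x) (C := C) volume_cube_lt_top
      (fun x _ => by simpa [norm_smul, norm_expChar] using hC x)
    rwa [volume_cube, ← one_mul C, ← pow_zero] at this
  | succ N ih =>
    intro G hG hper C hC
    -- The $N$-th derivative of the difference is at most $C\|h\|$ by the mean value inequality.
    -- With $\|h\|=\pi/|k_j|$ and the factor $2$ of the doubled integral, each induction step gains
    -- $\pi/(2|k_j|)$; the function varies in the induction because the hypothesis is applied to the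
    -- difference.
    set h := halfShift k j
    have hshift : ContDiff ℝ ∞ fun x => G (x + h) := hG.comp (contDiff_id.add contDiff_const)
    have hd : ∀ x, ‖iteratedFDeriv ℝ N (fun x => G x - G (x + h)) x‖ ≤ C * ‖h‖ := by
      intro x
      have e : iteratedFDeriv ℝ N (fun x => G x - G (x + h)) x =
          iteratedFDeriv ℝ N G x - iteratedFDeriv ℝ N G (x + h) := by
        rw [← iteratedFDeriv_comp_add_right]
        exact iteratedFDeriv_sub_apply (hG.contDiffAt.of_le (by exact_mod_cast le_top))
          (hshift.contDiffAt.of_le (by exact_mod_cast le_top))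
      rw [e, norm_sub_rev]
      have := Convex.norm_image_sub_le_of_norm_fderiv_le (𝕜 := ℝ) (f := iteratedFDeriv ℝ N G)
        (s := univ) (C := C) (x := x) (y := x + h)
        (fun y _ => (hG.differentiable_iteratedFDeriv
          (by exact_mod_cast WithTop.coe_lt_top N)) y)
        (fun y _ => by rw [norm_fderiv_iteratedFDeriv]; exact hC y)
        convex_univ (mem_univ _) (mem_univ _)
      simpa using this
    have key := ih (hG.sub hshift) (fun n x => by
      simp only [hper]
      congr 1
      convert hper n (x + h) using 2
      ext i
      simp only [Pi.add_apply]
      ring) hd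
    rw [← two_smul_integral_expChar_smul hj hG.continuous hper, norm_smul, norm_halfShift] at key
    have hk : (0 : ℝ) < |(k j : ℝ)| := by simpa using hj
    rw [Real.norm_ofNat] at key
    calc _ ≤ ((Real.pi / (2 * |(k j : ℝ)|)) ^ N * (C * (Real.pi / |(k j : ℝ)|)) *
          (2 * Real.pi) ^ d) / 2 := by linarith
      _ = _ := by
        rw [pow_succ]
        field_simp

end FourierDecay

lemma integral_expChar {k : FourierLattice d} (hk : k ≠ 0) : ∫ x in cube d, expChar k x = 0 := by
  obtain ⟨j, hj⟩ := Function.ne_iff.1 hk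
  have := two_smul_integral_expChar_smul (d := d) hj (G := fun _ => (1 : ℂ)) continuous_const
    (fun _ _ => rfl)
  simpa using this

/-! ### Differentiation under the integral over a box. -/

section ParametricIntegral

variable {p : ℕ} {E V : Type*} [NormedAddCommGroup E] [NormedSpace ℝ E] [NormedAddCommGroup V]
  [NormedSpace ℝ V]

lemma contDiff_fderiv_snd {F : (Fin p → ℝ) → E → V}
    (hF : ContDiff ℝ ∞ fun z : (Fin p → ℝ) × E => F z.1 z.2) :
    ContDiff ℝ ∞ fun z : (Fin p → ℝ) × E => fderiv ℝ (F z.1) z.2 := by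
  have h : ContDiff ℝ ∞ (Function.uncurry fun (z : (Fin p → ℝ) × E) => F z.1) :=
    hF.comp ((contDiff_fst.comp contDiff_fst).prodMk contDiff_snd)
  exact h.fderiv contDiff_snd (by exact_mod_cast le_top)

lemma contDiff_iteratedFDeriv_snd {F : (Fin p → ℝ) → E → V}
    (hF : ContDiff ℝ ∞ fun z : (Fin p → ℝ) × E => F z.1 z.2) (b : ℕ) :
    ContDiff ℝ ∞ fun z : (Fin p → ℝ) × E => iteratedFDeriv ℝ b (F z.1) z.2 := by
  induction b with
  | zero =>
    simp only [iteratedFDeriv_zero_eq_comp]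
    exact ((continuousMultilinearCurryFin0 ℝ E V).symm.toContinuousLinearEquiv.contDiff).comp hF
  | succ b ih =>
    simp only [iteratedFDeriv_succ_eq_comp_left]
    exact (((continuousMultilinearCurryLeftEquiv ℝ (fun _ : Fin (b + 1) => E)
      V).symm.toContinuousLinearEquiv.contDiff)).comp 
      (contDiff_fderiv_snd (F := fun x ξ => iteratedFDeriv ℝ b (F x) ξ) ih)

lemma contDiff_apply_left {F : (Fin p → ℝ) → E → V}
    (hF : ContDiff ℝ ∞ fun z : (Fin p → ℝ) × E => F z.1 z.2) (x : Fin p → ℝ) :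
    ContDiff ℝ ∞ (F x) := hF.comp (contDiff_const.prodMk contDiff_id)

lemma contDiff_apply_right {F : (Fin p → ℝ) → E → V}
    (hF : ContDiff ℝ ∞ fun z : (Fin p → ℝ) × E => F z.1 z.2) (ξ : E) :
    ContDiff ℝ ∞ fun x => F x ξ := hF.comp (contDiff_id.prodMk contDiff_const)

/-- The box times a closed unit ball around `ξ` is compact, `E` being finite-dimensional, so a
constant dominates the derivative of the integrand. -/
lemma hasFDerivAt_setIntegral_Icc [FiniteDimensional ℝ E] [CompleteSpace V]
    {F : (Fin p → ℝ) → E → V}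
    (hF : ContDiff ℝ ∞ fun z : (Fin p → ℝ) × E => F z.1 z.2) (a b : Fin p → ℝ) (ξ : E) :
    HasFDerivAt (fun η => ∫ x in Icc a b, F x η) (∫ x in Icc a b, fderiv ℝ (F x) ξ) ξ := by
  have : ProperSpace E := FiniteDimensional.proper ℝ E
  have hF' := contDiff_fderiv_snd hF
  obtain ⟨C, hC⟩ := ((isCompact_Icc (a := a) (b := b)).prod
    (isCompact_closedBall ξ 1)).exists_bound_of_continuousOn hF'.continuous.continuousOn
  refine hasFDerivAt_integral_of_dominated_of_fderiv_le (𝕜 := ℝ) (F := fun η x => F x η)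
    (F' := fun η x => fderiv ℝ (F x) η) (bound := fun _ => C)
    (Metric.closedBall_mem_nhds ξ one_pos) ?_ ?_ ?_ ?_ ?_ ?_
  · exact Filter.Eventually.of_forall fun η =>
      (contDiff_apply_right hF η).continuous.aestronglyMeasurable
  · exact (contDiff_apply_right hF ξ).continuous.continuousOn.integrableOn_compact isCompact_Icc
  · exact ((contDiff_apply_right hF' ξ).continuous.continuousOn.integrableOn_compact
      isCompact_Icc).aestronglyMeasurable
  · exact (ae_restrict_iff' measurableSet_Icc).2 (Filter.Eventually.of_forall
      fun x hx η hη => hC (x, η) ⟨hx, hη⟩)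
  · exact continuousOn_const.integrableOn_compact isCompact_Icc
  · exact Filter.Eventually.of_forall fun x η _ =>
      ((contDiff_apply_left hF x).differentiable (by simp) η).hasFDerivAt

lemma clm_setIntegral_Icc_fderiv {U : Type*} [NormedAddCommGroup U] [NormedSpace ℝ U]
    [CompleteSpace U] [CompleteSpace V] {F : (Fin p → ℝ) → E → V}
    (hF : ContDiff ℝ ∞ fun z : (Fin p → ℝ) × E => F z.1 z.2) (a b : Fin p → ℝ) (ξ : E)
    (T : (E →L[ℝ] V) →L[ℝ] U) :
    ∫ x in Icc a b, T (fderiv ℝ (F x) ξ) = T (∫ x in Icc a b, fderiv ℝ (F x) ξ) :=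
  T.integral_comp_comm ((contDiff_apply_right (F := fun x ξ => fderiv ℝ (F x) ξ)
    (contDiff_fderiv_snd hF) ξ).continuous.continuousOn.integrableOn_compact isCompact_Icc)

lemma iteratedFDeriv_setIntegral_Icc [FiniteDimensional ℝ E] [CompleteSpace V]
    {F : (Fin p → ℝ) → E → V}
    (hF : ContDiff ℝ ∞ fun z : (Fin p → ℝ) × E => F z.1 z.2) (a b : Fin p → ℝ) (n : ℕ) :
    iteratedFDeriv ℝ n (fun η => ∫ x in Icc a b, F x η) =
      fun ξ => ∫ x in Icc a b, iteratedFDeriv ℝ n (F x) ξ := by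
  induction n with
  | zero =>
    ext1 ξ
    simp only [iteratedFDeriv_zero_eq_comp, Function.comp_apply]
    exact ((continuousMultilinearCurryFin0 ℝ E
      V).symm.toContinuousLinearEquiv.integral_comp_comm _).symm
  | succ n ih =>
    ext1 ξ
    simp only [iteratedFDeriv_succ_eq_comp_left, Function.comp_apply]
    rw [ih, (hasFDerivAt_setIntegral_Icc (contDiff_iteratedFDeriv_snd hF n) a b ξ).fderiv]
    exact (clm_setIntegral_Icc_fderiv (contDiff_iteratedFDeriv_snd hF n) a b ξ
      (continuousMultilinearCurryLeftEquiv ℝ (fun _ : Fin (n + 1) => E)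
        V).symm.toContinuousLinearEquiv.toContinuousLinearMap).symm

lemma contDiff_setIntegral_Icc [FiniteDimensional ℝ E] [CompleteSpace V]
    {F : (Fin p → ℝ) → E → V}
    (hF : ContDiff ℝ ∞ fun z : (Fin p → ℝ) × E => F z.1 z.2) (a b : Fin p → ℝ) :
    ContDiff ℝ ∞ fun η => ∫ x in Icc a b, F x η := by
  refine contDiff_of_differentiable_iteratedFDeriv fun n _ => ?_
  rw [iteratedFDeriv_setIntegral_Icc hF]
  exact fun ξ => (hasFDerivAt_setIntegral_Icc
    (contDiff_iteratedFDeriv_snd hF n) a b ξ).differentiableAt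

end ParametricIntegral

variable {d : ℕ}

/-! ### Weights on the Fourier lattice -/

/-- The weight `1 + |k|`. -/
def weight (k : FourierLattice d) : ℝ := 1 + ‖toVec k‖

lemma one_le_weight (k : FourierLattice d) : 1 ≤ weight k := by
  simp [weight]

lemma weight_pos (k : FourierLattice d) : 0 < weight k := one_pos.trans_le (one_le_weight k)

lemma norm_toVec_le_weight (k : FourierLattice d) : ‖toVec k‖ ≤ weight k := by
  simp [weight]

lemma toVec_apply (k : FourierLattice d) (i : Fin d) : toVec k i = (k i : ℝ) := rfl

lemma toVec_eq_sum (k : FourierLattice d) :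
    toVec k = ∑ i, k i • (EuclideanSpace.basisFun (Fin d) ℝ).toBasis i := by
  ext j
  simp [toVec_apply, Pi.single_apply]

lemma abs_le_norm_toVec (k : FourierLattice d) (i : Fin d) : |(k i : ℝ)| ≤ ‖toVec k‖ :=
  PiLp.norm_apply_le (toVec k) i

lemma norm_toVec_le_sum (k : FourierLattice d) : ‖toVec k‖ ≤ ∑ i, |(k i : ℝ)| := by
  rw [toVec_eq_sum]
  refine (norm_sum_le _ _).trans (Finset.sum_le_sum fun i _ => ?_)
  rw [← Int.cast_smul_eq_zsmul ℝ, norm_smul]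
  simp

lemma toVec_injective : Function.Injective (toVec : FourierLattice d → Momentum d) := by
  intro k l h
  ext i
  have := congrArg (fun v : Momentum d => v i) h
  simpa [toVec_apply] using this

lemma toVec_ne_zero {k : FourierLattice d} (hk : k ≠ 0) : toVec k ≠ 0 := fun h =>
  hk (toVec_injective (by
    rw [h]
    ext i
    simp [toVec_apply]))

lemma exists_summable_weight (d : ℕ) :
    ∃ N : ℕ, Summable fun k : FourierLattice d => (weight k ^ N)⁻¹ := by
  set L := Submodule.span ℤ (range (EuclideanSpace.basisFun (Fin d) ℝ).toBasis)
  have hmem : ∀ k : FourierLattice d, toVec k ∈ L := fun k => by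
    rw [toVec_eq_sum]
    exact Submodule.sum_mem _ fun i _ => Submodule.smul_mem _ _ (Submodule.subset_span ⟨i, rfl⟩)
  set N := Module.finrank ℤ L + 1
  have hs := ZLattice.summable_norm_pow_inv (L := L) N (Nat.lt_succ_self _)
  have hinj : Function.Injective fun k : FourierLattice d => (⟨toVec k, hmem k⟩ : L) :=
    fun k l h => toVec_injective (congrArg Subtype.val h)
  -- At $k=0$ the inverse norm is the default value $0$ while the inverse weight is $1$; a unit mass
  -- at the origin corrects the majorant.
  have hs' := (hs.comp_injective hinj).add
    (hasSum_ite_eq (0 : FourierLattice d) (1 : ℝ)).summable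
  refine ⟨N, hs'.of_nonneg_of_le (fun k => inv_nonneg.2 (pow_nonneg (weight_pos k).le _))
    fun k => ?_⟩
  simp only [Function.comp_apply]
  by_cases hk : k = 0
  · subst hk
    have : (weight (0 : FourierLattice d) ^ N)⁻¹ ≤ 1 :=
      inv_le_one_of_one_le₀ (one_le_pow₀ (one_le_weight _))
    simp only [if_true]
    refine this.trans ?_
    simp
  · have hpos : 0 < ‖toVec k‖ := norm_pos_iff.2 (toVec_ne_zero hk)
    simp only [hk, if_false, add_zero]
    rw [inv_pow]
    refine inv_anti₀ (pow_pos hpos _) ?_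
    exact pow_le_pow_left₀ hpos.le (norm_toVec_le_weight k) _

/-- The index `j` maximises $|k_j|\ge1$. This turns decay in one coordinate into decay in the
weight. -/
lemma exists_weight_le {k : FourierLattice d} (hk : k ≠ 0) :
    ∃ j, k j ≠ 0 ∧ weight k ≤ (d + 1) * |(k j : ℝ)| := by
  obtain ⟨i, hi⟩ := Function.ne_iff.1 hk
  have : Nonempty (Fin d) := ⟨i⟩
  obtain ⟨j, hj⟩ := Finite.exists_max fun i => |(k i : ℝ)|
  have hj1 : k j ≠ 0 := by
    intro h0
    have := hj i
    rw [h0] at this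
    have h : (k i : ℝ) = 0 := by simpa using this
    exact hi (by exact_mod_cast h)
  refine ⟨j, hj1, ?_⟩
  have h1 : (1 : ℝ) ≤ |(k j : ℝ)| := by exact_mod_cast Int.one_le_abs hj1
  have h2 : ‖toVec k‖ ≤ d * |(k j : ℝ)| :=
    (norm_toVec_le_sum k).trans ((Finset.sum_le_sum fun i _ => hj i).trans (by simp))
  rw [weight]
  linarith

/-! ### Derivatives of characters -/

lemma norm_iteratedFDeriv_comp_clm_le {E F G : Type*} [NormedAddCommGroup E] [NormedSpace ℝ E]
    [NormedAddCommGroup F] [NormedSpace ℝ F] [NormedAddCommGroup G] [NormedSpace ℝ G]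
    {g : F → G} (hg : ContDiff ℝ ∞ g) (L : E →L[ℝ] F) (n : ℕ) (x : E) :
    ‖iteratedFDeriv ℝ n (fun y => g (L y)) x‖ ≤ ‖iteratedFDeriv ℝ n g (L x)‖ * ‖L‖ ^ n := by
  have := L.iteratedFDeriv_comp_right hg x (i := n) (by exact_mod_cast le_top)
  rw [Function.comp_def] at this
  rw [this]
  refine (ContinuousMultilinearMap.norm_compContinuousLinearMap_le _ _).trans ?_
  simp

lemma norm_iteratedFDeriv_cexp_mul_I (n : ℕ) (t : ℝ) :
    ‖iteratedFDeriv ℝ n (fun t : ℝ => Complex.exp ((t : ℂ) * Complex.I)) t‖ = 1 := by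
  have h : iteratedDeriv n (fun t : ℝ => Complex.exp ((t : ℂ) * Complex.I)) =
      fun t : ℝ => Complex.I ^ n * Complex.exp ((t : ℂ) * Complex.I) := by
    induction n with
    | zero => simp
    | succ n ih =>
      rw [iteratedDeriv_succ, ih]
      ext t
      have h1 : HasDerivAt (fun t : ℝ => Complex.exp ((t : ℂ) * Complex.I))
          (Complex.exp ((t : ℂ) * Complex.I) * (1 * Complex.I)) t :=
        ((Complex.ofRealCLM.hasDerivAt (x := t)).mul_const Complex.I).cexp
      rw [(h1.const_mul (Complex.I ^ n)).deriv]
      ring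
  rw [norm_iteratedFDeriv_eq_norm_iteratedDeriv, h]
  simp [Complex.norm_exp_ofReal_mul_I]

lemma norm_pairingCLM_le (k : FourierLattice d) : ‖pairingCLM k‖ ≤ d * weight k := by
  refine (norm_sum_le _ _).trans ?_
  have : ∀ i ∈ Finset.univ, ‖(k i : ℝ) • (ContinuousLinearMap.proj i :
      (Fin d → ℝ) →L[ℝ] ℝ)‖ ≤ weight k := fun i _ => by
    rw [norm_smul]
    have h1 : ‖(ContinuousLinearMap.proj i : (Fin d → ℝ) →L[ℝ] ℝ)‖ ≤ 1 :=
      ContinuousLinearMap.opNorm_le_bound _ zero_le_one fun x => by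
        simpa using norm_le_pi_norm x i
    calc _ ≤ ‖(k i : ℝ)‖ * 1 := by gcongr
      _ ≤ weight k := by
        rw [mul_one]
        exact (abs_le_norm_toVec k i).trans (norm_toVec_le_weight k)
  refine (Finset.sum_le_sum this).trans ?_
  simp

lemma norm_iteratedFDeriv_expChar_le (k : FourierLattice d) (n : ℕ) (x : Fin d → ℝ) :
    ‖iteratedFDeriv ℝ n (expChar k) x‖ ≤ (d * weight k) ^ n := by
  rw [expChar_eq]
  refine (norm_iteratedFDeriv_comp_clm_le
    ((Complex.ofRealCLM.contDiff.mul contDiff_const).cexp) (pairingCLM k) n x).trans ?_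
  have := norm_iteratedFDeriv_cexp_mul_I n (pairingCLM k x)
  simp only [Complex.ofRealCLM_apply]
  rw [this, one_mul]
  exact pow_le_pow_left₀ (norm_nonneg _) (norm_pairingCLM_le k) n

/-! ### Fourier coefficients of symbols -/

section Coefficients

variable {f : (Fin d → ℝ) → Momentum d → ℂ}

lemma contDiff_expChar_mul (hf : ContDiff ℝ ∞ fun z : (Fin d → ℝ) × Momentum d => f z.1 z.2)
    (k : FourierLattice d) :
    ContDiff ℝ ∞ fun z : (Fin d → ℝ) × Momentum d => expChar k z.1 * f z.1 z.2 :=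
  ((contDiff_expChar k).comp contDiff_fst).mul hf

lemma contDiff_fourierCoeffX
    (hf : ContDiff ℝ ∞ fun z : (Fin d → ℝ) × Momentum d => f z.1 z.2) (k : FourierLattice d) :
    ContDiff ℝ ∞ (fourierCoeffX f k) :=
  contDiff_const.mul (contDiff_setIntegral_Icc (F := fun x ξ => expChar (-k) x * f x ξ)
    (contDiff_expChar_mul hf (-k)) _ _)

lemma iteratedFDeriv_fourierCoeffX
    (hf : ContDiff ℝ ∞ fun z : (Fin d → ℝ) × Momentum d => f z.1 z.2) (k : FourierLattice d)
    (b : ℕ) (ξ : Momentum d) :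
    iteratedFDeriv ℝ b (fourierCoeffX f k) ξ = ((2 * Real.pi) ^ d)⁻¹ •
      ∫ x in cube d, expChar (-k) x • iteratedFDeriv ℝ b (f x) ξ := by
  have h1 : fourierCoeffX f k = ((2 * Real.pi) ^ d)⁻¹ • fun ξ =>
      ∫ x in cube d, expChar (-k) x * f x ξ := by
    ext ξ
    simp [fourierCoeffX]
  have hs := contDiff_expChar_mul hf (-k)
  rw [h1, iteratedFDeriv_const_smul_apply
    ((contDiff_setIntegral_Icc (F := fun x ξ => expChar (-k) x * f x ξ) hs _ _).contDiffAt.of_le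
      (by exact_mod_cast le_top)),
    iteratedFDeriv_setIntegral_Icc (F := fun x ξ => expChar (-k) x * f x ξ) hs]
  congr 1
  refine integral_congr_ae (Filter.Eventually.of_forall fun x => ?_)
  exact iteratedFDeriv_const_smul_apply (a := expChar (-k) x)
    ((contDiff_apply_left hf x).contDiffAt.of_le (by exact_mod_cast le_top))

end Coefficients

/-- Decay of the Fourier coefficients of a symbol. -/
lemma exists_fourierCoeffX_decay {m δ : ℝ} {K : Family d} (hK : IsGlobalSymbol m δ K)
    (b N : ℕ) : ∃ C : ℝ, 0 < C ∧ ∀ ħ ∈ Ioc (0 : ℝ) 1, ∀ k ξ,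
      weight k ^ N * ‖iteratedFDeriv ℝ b (fourierCoeffX (K ħ) k) ξ‖ ≤ C * ħ ^ (m - δ * b) := by
  obtain ⟨C₀, hC₀, h₀⟩ := hK.2 0 b
  obtain ⟨C₁, hC₁, h₁⟩ := hK.2 N b
  -- This is the $N$-th power of the product of the bound $(d+1)|k_j|$ for the weight and the gain
  -- $\pi/(2|k_j|)$ per derivative. The constant `C₀` serves $k=0$, where nothing oscillates.
  set D : ℝ := ((d + 1) * Real.pi / 2) ^ N
  have hD : 0 < D := by positivity
  refine ⟨C₀ + D * C₁, by positivity, fun ħ hħ k ξ => ?_⟩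
  obtain ⟨hsm, hper⟩ := hK.1 ħ hħ
  have hħ' : 0 < ħ ^ (m - δ * b) := Real.rpow_pos_of_pos hħ.1 _
  have hG : ContDiff ℝ ∞ fun x => iteratedFDeriv ℝ b (K ħ x) ξ :=
    contDiff_apply_right (F := fun x ξ => iteratedFDeriv ℝ b (K ħ x) ξ)
      (contDiff_iteratedFDeriv_snd hsm b) ξ
  have hGper : ∀ (n : FourierLattice d) x,
      iteratedFDeriv ℝ b (K ħ fun i => x i + 2 * Real.pi * (n i : ℝ)) ξ =
        iteratedFDeriv ℝ b (K ħ x) ξ := fun n x => by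
    congr 1
    ext η
    exact hper n x η
  have hpi : (0 : ℝ) < (2 * Real.pi) ^ d := by positivity
  rw [iteratedFDeriv_fourierCoeffX hsm, norm_smul, Real.norm_of_nonneg (by positivity)]
  by_cases hk : k = 0
  · subst hk
    have hw : weight (0 : FourierLattice d) = 1 := by
      have : toVec (0 : FourierLattice d) = 0 := by
        ext i
        simp [toVec_apply]
      simp [weight, this]
    have hb := norm_setIntegral_le_of_norm_le_const (μ := volume) (s := cube d)
      (f := fun x => expChar (-0) x • iteratedFDeriv ℝ b (K ħ x) ξ)
      (C := C₀ * ħ ^ (m - δ * b)) volume_cube_lt_top (fun x _ => by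
        rw [norm_smul, norm_expChar, one_mul]
        simpa using h₀ ħ hħ x ξ trivial)
    rw [volume_cube] at hb
    rw [hw, one_pow, one_mul]
    calc _ ≤ ((2 * Real.pi) ^ d)⁻¹ * (C₀ * ħ ^ (m - δ * b) * (2 * Real.pi) ^ d) := by gcongr
      _ = C₀ * ħ ^ (m - δ * b) := by field_simp
      _ ≤ _ := by gcongr; linarith [mul_pos hD hC₁]
  · obtain ⟨j, hj, hjw⟩ := exists_weight_le hk
    have hj' : (-k) j ≠ 0 := by simpa using hj
    have hb := norm_integral_expChar_smul_le hj' N hG hGper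
      (C := C₁ * ħ ^ (m - δ * b)) (fun x => h₁ ħ hħ x ξ trivial)
    have hkj : (0 : ℝ) < |(k j : ℝ)| := by simpa using hj
    have habs : |(((-k) j : ℤ) : ℝ)| = |(k j : ℝ)| := by simp
    rw [habs] at hb
    have hwD : weight k ^ N * (Real.pi / (2 * |(k j : ℝ)|)) ^ N ≤ D := by
      rw [← mul_pow]
      refine pow_le_pow_left₀ (mul_nonneg (weight_pos k).le (by positivity)) ?_ N
      rw [← mul_div_assoc, div_le_div_iff₀ (by positivity) two_pos]
      have := Real.pi_pos
      nlinarith [mul_le_mul_of_nonneg_right hjw this.le]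
    calc _ ≤ weight k ^ N * (((2 * Real.pi) ^ d)⁻¹ *
          ((Real.pi / (2 * |(k j : ℝ)|)) ^ N * (C₁ * ħ ^ (m - δ * b)) * (2 * Real.pi) ^ d)) := by
          have := (weight_pos k).le
          gcongr
      _ = (weight k ^ N * (Real.pi / (2 * |(k j : ℝ)|)) ^ N) * (C₁ * ħ ^ (m - δ * b)) := by
          field_simp
      _ ≤ D * (C₁ * ħ ^ (m - δ * b)) := by gcongr
      _ ≤ _ := by
          rw [← mul_assoc]
          gcongr
          linarith

variable {d : ℕ}

/-! ### Fourier multipliers depending on the momentum -/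

/-- The family with Fourier coefficients `c_k(ξ) K̃(k, ξ)`. -/
def multiplierSymbol (c : ℝ → FourierLattice d → Momentum d → ℂ) (K : Family d) : Family d :=
  fun ħ x ξ => ∑' k, c ħ k ξ * fourierCoeffX (K ħ) k ξ * expChar k x

/-- The derivatives of order `b` of the multipliers `c_k` are bounded by `ħ^(M - δ b)` on `S`, up to
a power of `1 + |k|`. -/
def MultiplierBound (δ M : ℝ) (S : ℝ → Set (Momentum d))
    (c : ℝ → FourierLattice d → Momentum d → ℂ) : Prop :=
  ∀ b : ℕ, ∃ (C : ℝ) (p : ℕ), 0 < C ∧ ∀ ħ ∈ Ioc (0 : ℝ) 1, ∀ k, ∀ ξ ∈ S ħ,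
    ‖iteratedFDeriv ℝ b (c ħ k) ξ‖ ≤ C * weight k ^ p * ħ ^ (M - δ * b)

/-- Smooth multipliers with the bounds of order `0` on the whole momentum space. -/
structure IsMultiplier (δ : ℝ) (c : ℝ → FourierLattice d → Momentum d → ℂ) : Prop where
  smooth : ∀ ħ ∈ Ioc (0 : ℝ) 1, ∀ k, ContDiff ℝ ∞ (c ħ k)
  bound : MultiplierBound δ 0 (fun _ => univ) c

lemma IsSymbol.congr {m δ : ℝ} {S : ℝ → Set ((Fin d → ℝ) × Momentum d)} {P Q : Family d}
    (hP : IsSymbol m δ S P) (h : ∀ ħ ∈ Ioc (0 : ℝ) 1, ∀ x ξ, P ħ x ξ = Q ħ x ξ) :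
    IsSymbol m δ S Q := by
  have h' : ∀ ħ ∈ Ioc (0 : ℝ) 1, P ħ = Q ħ := fun ħ hħ => by
    ext x ξ
    exact h ħ hħ x ξ
  refine ⟨fun ħ hħ => by rw [← h' ħ hħ]; exact hP.1 ħ hħ, fun a b => ?_⟩
  obtain ⟨C, hC, hb⟩ := hP.2 a b
  exact ⟨C, hC, fun ħ hħ => by rw [← h' ħ hħ]; exact hb ħ hħ⟩

section Region

variable {m M δ : ℝ} {S : ℝ → Set (Momentum d)}
  {c : ℝ → FourierLattice d → Momentum d → ℂ} {K : Family d}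

/-- The multiplied Fourier coefficients satisfy the product bound, with arbitrary decay. -/
lemma exists_multiplied_coeff_decay
    (hc : ∀ ħ ∈ Ioc (0 : ℝ) 1, ∀ k, ContDiff ℝ ∞ (c ħ k)) (hS : MultiplierBound δ M S c)
    (hK : IsGlobalSymbol m δ K) (b N : ℕ) :
    ∃ C : ℝ, 0 < C ∧ ∀ ħ ∈ Ioc (0 : ℝ) 1, ∀ k, ∀ ξ ∈ S ħ,
      weight k ^ N * ‖iteratedFDeriv ℝ b (fun η => c ħ k η * fourierCoeffX (K ħ) k η) ξ‖
        ≤ C * ħ ^ (m + M - δ * b) := by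
  choose C p hC hCb using hS
  -- The coefficient bounds are taken with `p i` extra powers of the weight, which absorb the growth
  -- of the multiplier in the Leibniz formula. The exponents of $\hbar$ then add up independently of
  -- `i`.
  choose D hD hDb using fun i => exists_fourierCoeffX_decay hK (b - i) (N + p i)
  refine ⟨∑ i ∈ Finset.range (b + 1), (b.choose i : ℝ) * (C i * D i),
    Finset.sum_pos (fun i hi => ?_) ⟨0, by simp⟩, fun ħ hħ k ξ hξ => ?_⟩
  · have : 0 < b.choose i := Nat.choose_pos (Nat.lt_succ_iff.1 (Finset.mem_range.1 hi))
    have := hC i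
    have := hD i
    positivity
  have hle := norm_iteratedFDeriv_mul_le (𝕜 := ℝ) (n := b) (N := ∞) (hc ħ hħ k)
    (contDiff_fourierCoeffX (hK.1 ħ hħ).1 k) ξ (by exact_mod_cast le_top)
  have hw := (weight_pos k).le
  refine (mul_le_mul_of_nonneg_left hle (pow_nonneg hw N)).trans ?_
  rw [Finset.mul_sum, Finset.sum_mul]
  refine Finset.sum_le_sum fun i hi => ?_
  have hib : i ≤ b := Nat.lt_succ_iff.1 (Finset.mem_range.1 hi)
  have h1 := hCb i ħ hħ k ξ hξ
  have h2 := hDb i ħ hħ k ξ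
  have hħ1 : 0 ≤ ħ ^ (M - δ * i) := (Real.rpow_pos_of_pos hħ.1 _).le
  have hpow : ħ ^ (M - δ * i) * ħ ^ (m - δ * ((b - i : ℕ) : ℝ)) = ħ ^ (m + M - δ * b) := by
    rw [← Real.rpow_add hħ.1, Nat.cast_sub hib]
    congr 1
    ring
  have hCi := (hC i).le
  calc _ ≤ weight k ^ N * (b.choose i * (C i * weight k ^ p i * ħ ^ (M - δ * i)) *
        ‖iteratedFDeriv ℝ (b - i) (fourierCoeffX (K ħ) k) ξ‖) := by gcongr
    _ = b.choose i * C i * ħ ^ (M - δ * i) * (weight k ^ (N + p i) *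
        ‖iteratedFDeriv ℝ (b - i) (fourierCoeffX (K ħ) k) ξ‖) := by ring
    _ ≤ b.choose i * C i * ħ ^ (M - δ * i) * (D i * ħ ^ (m - δ * ((b - i : ℕ) : ℝ))) := by
        gcongr
    _ = b.choose i * (C i * D i) * (ħ ^ (M - δ * i) * ħ ^ (m - δ * ((b - i : ℕ) : ℝ))) := by ring
    _ = _ := by rw [hpow]

end Region

/-! ### Fourier series with rapidly decreasing coefficients. -/

section Series

/-- A family of smooth functions all of whose derivatives decrease rapidly in `k`. -/
structure IsRapidlyDecreasing (f : FourierLattice d → Momentum d → ℂ) : Prop where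
  smooth : ∀ k, ContDiff ℝ ∞ (f k)
  decay : ∀ b N : ℕ, ∃ C : ℝ, ∀ k ξ, weight k ^ N * ‖iteratedFDeriv ℝ b (f k) ξ‖ ≤ C

variable {f : FourierLattice d → Momentum d → ℂ}

lemma IsRapidlyDecreasing.decay_le (hf : IsRapidlyDecreasing f) (b p N : ℕ) :
    ∃ C : ℝ, ∀ k ξ, weight k ^ p * ‖iteratedFDeriv ℝ b (f k) ξ‖ ≤ C * (weight k ^ N)⁻¹ := by
  obtain ⟨C, hC⟩ := hf.decay b (N + p)
  refine ⟨C, fun k ξ => ?_⟩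
  rw [← div_eq_mul_inv, le_div_iff₀ (pow_pos (weight_pos k) N)]
  calc _ = weight k ^ (N + p) * ‖iteratedFDeriv ℝ b (f k) ξ‖ := by ring
    _ ≤ C := hC k ξ

lemma IsRapidlyDecreasing.summable_norm (hf : IsRapidlyDecreasing f) (ξ : Momentum d) :
    Summable fun k => ‖f k ξ‖ := by
  obtain ⟨N, hN⟩ := exists_summable_weight d
  obtain ⟨C, hC⟩ := hf.decay_le 0 0 N
  refine (hN.mul_left C).of_nonneg_of_le (fun k => norm_nonneg _) fun k => ?_
  simpa using hC k ξ

/-- In the Leibniz formula, $n-i$ derivatives of the character cost that many powers of the weight;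
rapid decay absorbs them and still leaves a summable majorant at every order. -/
lemma contDiff_tsum_mul_expChar (hf : IsRapidlyDecreasing f) :
    ContDiff ℝ ∞ fun z : (Fin d → ℝ) × Momentum d => ∑' k, f k z.2 * expChar k z.1 := by
  obtain ⟨N, hN⟩ := exists_summable_weight d
  choose C hC using fun i p => hf.decay_le i p N
  have hsm1 : ∀ k, ContDiff ℝ ∞ fun z : (Fin d → ℝ) × Momentum d => f k z.2 :=
    fun k => (hf.smooth k).comp contDiff_snd
  have hsm2 : ∀ k, ContDiff ℝ ∞ fun z : (Fin d → ℝ) × Momentum d => expChar k z.1 :=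
    fun k => (contDiff_expChar k).comp contDiff_fst
  refine contDiff_tsum (N := (⊤ : ℕ∞)) (v := fun n k => ∑ i ∈ Finset.range (n + 1),
    (n.choose i : ℝ) * ((d : ℝ) ^ (n - i) * (C i (n - i) * (weight k ^ N)⁻¹)))
    (fun k => (hsm1 k).mul (hsm2 k)) (fun n _ => ?_) (fun n k z _ => ?_)
  · exact summable_sum fun i _ => ((hN.mul_left _).mul_left _).mul_left _
  · refine (norm_iteratedFDeriv_mul_le (𝕜 := ℝ) (n := n) (N := ∞) (hsm1 k) (hsm2 k) z
      (by exact_mod_cast le_top)).trans (Finset.sum_le_sum fun i _ => ?_)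
    have h1 : ‖iteratedFDeriv ℝ i (fun z : (Fin d → ℝ) × Momentum d => f k z.2) z‖ ≤
        ‖iteratedFDeriv ℝ i (f k) z.2‖ := by
      refine (norm_iteratedFDeriv_comp_clm_le (hf.smooth k)
        (ContinuousLinearMap.snd ℝ (Fin d → ℝ) (Momentum d)) i z).trans ?_
      exact mul_le_of_le_one_right (norm_nonneg _)
        (pow_le_one₀ (norm_nonneg _) (ContinuousLinearMap.norm_snd_le _ _ _))
    have h2 : ‖iteratedFDeriv ℝ (n - i) (fun z : (Fin d → ℝ) × Momentum d => expChar k z.1) z‖ ≤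
        (d * weight k) ^ (n - i) := by
      refine (norm_iteratedFDeriv_comp_clm_le (contDiff_expChar k)
        (ContinuousLinearMap.fst ℝ (Fin d → ℝ) (Momentum d)) (n - i) z).trans ?_
      refine (mul_le_of_le_one_right (norm_nonneg _)
        (pow_le_one₀ (norm_nonneg _) (ContinuousLinearMap.norm_fst_le _ _ _))).trans ?_
      exact norm_iteratedFDeriv_expChar_le k _ _
    have hw := (weight_pos k).le
    calc _ ≤ n.choose i * ‖iteratedFDeriv ℝ i (f k) z.2‖ * (d * weight k) ^ (n - i) := by gcongr
      _ = n.choose i * ((d : ℝ) ^ (n - i) *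
          (weight k ^ (n - i) * ‖iteratedFDeriv ℝ i (f k) z.2‖)) := by ring
      _ ≤ _ := mul_le_mul_of_nonneg_left
        (mul_le_mul_of_nonneg_left (hC i (n - i) k z.2) (by positivity)) (by positivity)

lemma iteratedFDeriv_mul_expChar (hf : ∀ k, ContDiff ℝ ∞ (f k)) (b : ℕ) (k : FourierLattice d)
    (y : Fin d → ℝ) (ξ : Momentum d) :
    iteratedFDeriv ℝ b (fun η => f k η * expChar k y) ξ =
      expChar k y • iteratedFDeriv ℝ b (f k) ξ := by
  simp only [mul_comm (f k _)]
  exact iteratedFDeriv_const_smul_apply (a := expChar k y)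
    ((hf k).contDiffAt.of_le (by exact_mod_cast le_top))

lemma iteratedFDeriv_tsum_mul_expChar (hf : IsRapidlyDecreasing f) (b : ℕ) (y : Fin d → ℝ)
    (ξ : Momentum d) :
    iteratedFDeriv ℝ b (fun η => ∑' k, f k η * expChar k y) ξ =
      ∑' k, expChar k y • iteratedFDeriv ℝ b (f k) ξ := by
  obtain ⟨N, hN⟩ := exists_summable_weight d
  choose C hC using fun i => hf.decay_le i 0 N
  rw [iteratedFDeriv_tsum_apply (N := (⊤ : ℕ∞)) (v := fun n k => C n * (weight k ^ N)⁻¹)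
    (fun k => (hf.smooth k).mul contDiff_const) (fun n _ => hN.mul_left _)
    (fun n k ξ _ => ?_) (by exact_mod_cast le_top)]
  · simp only [iteratedFDeriv_mul_expChar hf.smooth]
  · rw [iteratedFDeriv_mul_expChar hf.smooth, norm_smul, norm_expChar, one_mul]
    simpa using hC n k ξ

lemma norm_iteratedFDeriv_expChar_smul_le {V : Type*} [NormedAddCommGroup V] [NormedSpace ℝ V]
    [NormedSpace ℂ V] [IsScalarTower ℝ ℂ V] (k : FourierLattice d) (v : V) (n : ℕ)
    (x : Fin d → ℝ) :
    ‖iteratedFDeriv ℝ n (fun y => expChar k y • v) x‖ ≤ (d * weight k) ^ n * ‖v‖ := by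
  let T : ℂ →L[ℝ] V := ((1 : ℂ →L[ℂ] ℂ).smulRight v).restrictScalars ℝ
  have hT : ‖T‖ ≤ ‖v‖ := T.opNorm_le_bound (norm_nonneg v) fun z => by
    simp [T, norm_smul, mul_comm]
  have h := T.norm_iteratedFDeriv_comp_left (f := expChar k) (x := x) (n := n) (N := ∞)
    (contDiff_expChar k).contDiffAt (by exact_mod_cast le_top)
  refine (le_trans (le_of_eq rfl) h).trans ?_
  rw [mul_comm]
  exact mul_le_mul (norm_iteratedFDeriv_expChar_le k n x) hT (norm_nonneg _)
    (pow_nonneg (mul_nonneg d.cast_nonneg (weight_pos k).le) n)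

/-- Global decay justifies termwise differentiation, but the final constant involves the
coefficients at the single point `ξ` only. Estimates over a set `S` therefore follow without any
openness of `S`. -/
lemma norm_mixed_deriv_tsum_mul_expChar_le (hf : IsRapidlyDecreasing f) (a b N : ℕ)
    (hN : Summable fun k : FourierLattice d => (weight k ^ N)⁻¹) (x : Fin d → ℝ) (ξ : Momentum d)
    {B : ℝ} (hB : ∀ k, weight k ^ (N + a) * ‖iteratedFDeriv ℝ b (f k) ξ‖ ≤ B) :
    ‖iteratedFDeriv ℝ a
      (fun y => iteratedFDeriv ℝ b (fun η => ∑' k, f k η * expChar k y) ξ) x‖ ≤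
      (d : ℝ) ^ a * B * ∑' k : FourierLattice d, (weight k ^ N)⁻¹ := by
  choose C hC using fun p => hf.decay_le b p N
  have hv : ∀ n k x, ‖iteratedFDeriv ℝ n (fun y => expChar k y • iteratedFDeriv ℝ b (f k) ξ) x‖ ≤
      (d : ℝ) ^ n * (weight k ^ n * ‖iteratedFDeriv ℝ b (f k) ξ‖) := fun n k x => by
    rw [← mul_assoc, ← mul_pow]
    exact norm_iteratedFDeriv_expChar_smul_le k _ n x
  simp only [iteratedFDeriv_tsum_mul_expChar hf]
  rw [iteratedFDeriv_tsum_apply (N := (⊤ : ℕ∞))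
    (f := fun k y => expChar k y • iteratedFDeriv ℝ b (f k) ξ)
    (v := fun n k => (d : ℝ) ^ n * (C n * (weight k ^ N)⁻¹))
    (fun k => (contDiff_expChar k).smul contDiff_const)
    (fun n _ => (hN.mul_left _).mul_left _)
    (fun n k x _ => (hv n k x).trans (mul_le_mul_of_nonneg_left (hC n k ξ) (by positivity))) (by exact_mod_cast le_top)]
  refine tsum_of_norm_bounded (hN.hasSum.mul_left ((d : ℝ) ^ a * B)) fun k => ?_
  refine (hv a k x).trans ?_
  rw [mul_assoc]
  refine mul_le_mul_of_nonneg_left ?_ (by positivity)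
  rw [← div_eq_mul_inv, le_div_iff₀ (pow_pos (weight_pos k) N)]
  calc _ = weight k ^ (N + a) * ‖iteratedFDeriv ℝ b (f k) ξ‖ := by ring
    _ ≤ B := hB k

end Series

/-! ### From multiplier bounds to symbol bounds. -/

section Region

variable {m M δ : ℝ} {S : ℝ → Set (Momentum d)}
  {c : ℝ → FourierLattice d → Momentum d → ℂ} {K : Family d}

lemma IsMultiplier.isRapidlyDecreasing (hc : IsMultiplier δ c) (hK : IsGlobalSymbol m δ K)
    {ħ : ℝ} (hħ : ħ ∈ Ioc (0 : ℝ) 1) :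
    IsRapidlyDecreasing fun k ξ => c ħ k ξ * fourierCoeffX (K ħ) k ξ where
  smooth k := (hc.smooth ħ hħ k).mul (contDiff_fourierCoeffX (hK.1 ħ hħ).1 k)
  decay b N := by
    obtain ⟨C, -, hC⟩ := exists_multiplied_coeff_decay hc.smooth hc.bound hK b N
    exact ⟨_, fun k ξ => hC ħ hħ k ξ trivial⟩

/-- Multipliers that are small on `S` map symbols to symbols that are small on `S`. -/
theorem IsMultiplier.isSymbol (hc : IsMultiplier δ c) (hS : MultiplierBound δ M S c)
    (hK : IsGlobalSymbol m δ K) :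
    IsSymbol (m + M) δ (fun ħ => univ ×ˢ S ħ) (multiplierSymbol c K) := by
  refine ⟨fun ħ hħ => ⟨contDiff_tsum_mul_expChar (hc.isRapidlyDecreasing hK hħ),
    fun n x ξ => ?_⟩, fun a b => ?_⟩
  · simp only [multiplierSymbol, expChar_periodic]
  obtain ⟨N, hN⟩ := exists_summable_weight d
  obtain ⟨C, hC, hCb⟩ := exists_multiplied_coeff_decay hc.smooth hS hK b (N + a)
  have h0 : 0 ≤ ∑' k : FourierLattice d, (weight k ^ N)⁻¹ :=
    tsum_nonneg fun k => inv_nonneg.2 (pow_nonneg (weight_pos k).le _)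
  -- The summand $1$ keeps the constant positive when $d=0$ and $a>0$.
  refine ⟨(d : ℝ) ^ a * C * (∑' k : FourierLattice d, (weight k ^ N)⁻¹) + 1, by positivity,
    fun ħ hħ x ξ hξ => ?_⟩
  have hħ' := (Real.rpow_pos_of_pos hħ.1 (m + M - δ * b)).le
  refine (norm_mixed_deriv_tsum_mul_expChar_le (hc.isRapidlyDecreasing hK hħ) a b N hN x ξ
    fun k => hCb ħ hħ k ξ hξ.2).trans ?_
  calc _ = (d : ℝ) ^ a * C * (∑' k : FourierLattice d, (weight k ^ N)⁻¹) *
        ħ ^ (m + M - δ * b) := by ring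
    _ ≤ _ := by gcongr; linarith

theorem IsMultiplier.isGlobalSymbol (hc : IsMultiplier δ c) (hK : IsGlobalSymbol m δ K) :
    IsGlobalSymbol m δ (multiplierSymbol c K) := by
  simpa [IsGlobalSymbol] using hc.isSymbol hc.bound hK

theorem IsMultiplier.isNegligibleOn (hc : IsMultiplier δ c)
    (hS : ∀ M, MultiplierBound δ M S c) (hK : IsGlobalSymbol m δ K) :
    IsNegligibleOn δ (fun ħ => univ ×ˢ S ħ) (multiplierSymbol c K) := fun M => by
  simpa using hc.isSymbol (hS (M - m)) hK

end Region

variable {d : ℕ}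

/-! ### Fourier series and their coefficients -/

/-- Orthogonality of characters; absolute summability allows exchanging sum and integral. -/
lemma fourierCoeffX_tsum {g : FourierLattice d → Momentum d → ℂ} {ξ : Momentum d}
    (hg : Summable fun l => ‖g l ξ‖) (k : FourierLattice d) :
    fourierCoeffX (fun x ξ => ∑' l, g l ξ * expChar l x) k ξ = g k ξ := by
  have hterm : ∀ l x, expChar (-k) x * (g l ξ * expChar l x) = g l ξ * expChar (l - k) x := by
    intro l x
    rw [sub_eq_add_neg, expChar_add_left]
    ring
  have hint : ∀ l, IntegrableOn (fun x => g l ξ * expChar (l - k) x) (cube d) := fun l =>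
    (continuous_const.mul (continuous_expChar _)).continuousOn.integrableOn_compact isCompact_Icc
  have hval : ∀ l, ∫ x in cube d, g l ξ * expChar (l - k) x =
      if l = k then (((2 * Real.pi) ^ d : ℝ) : ℂ) * g l ξ else 0 := by
    intro l
    rw [integral_const_mul]
    split_ifs with h
    · subst h
      simp only [sub_self, expChar_zero_left]
      rw [setIntegral_const, volume_cube]
      simp [mul_comm]
    · rw [integral_expChar (sub_ne_zero.2 h), mul_zero]
  have hsum : Summable fun l => ∫ x in cube d, ‖g l ξ * expChar (l - k) x‖ := by
    simp only [norm_mul, norm_expChar, mul_one, setIntegral_const, volume_cube]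
    exact hg.const_smul _
  have hpi : (((2 * Real.pi) ^ d : ℝ) : ℂ) ≠ 0 := by
    exact_mod_cast (pow_pos Real.two_pi_pos d).ne'
  simp only [fourierCoeffX, ← tsum_mul_left, hterm]
  rw [← integral_tsum_of_summable_integral_norm hint hsum]
  simp only [hval, tsum_ite_eq]
  rw [Complex.ofReal_inv, inv_mul_cancel_left₀ hpi]

/-- Conjugation exchanges the characters of $k$ and $-k$, so taking adjoints is an operation on
Fourier coefficients alone. -/
lemma adjointSymbol_eq_tsum (P : Family d) (ħ : ℝ) (x : Fin d → ℝ) (ξ : Momentum d) :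
    adjointSymbol P ħ x ξ = ∑' k : FourierLattice d,
      (starRingEnd ℂ) (fourierCoeffX (P ħ) (-k) (ξ + ħ • toVec k)) * expChar k x := by
  refine tsum_congr fun k => ?_
  simp only [fourierCoeffX, map_mul, ← integral_conj, expChar_sub, mul_assoc, integral_const_mul,
    expChar_neg_left, neg_neg, Complex.conj_ofReal]
  ring

lemma toVec_neg (k : FourierLattice d) : toVec (-k) = -toVec k := by
  ext i
  simp [toVec_apply]

lemma weight_neg (k : FourierLattice d) : weight (-k) = weight k := by
  simp [weight, toVec_neg]

/-! ### Self-adjointness and adjoints in terms of Fourier coefficients. -/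

section SelfAdjoint

variable {m δ : ℝ} {K : Family d} {ħ : ℝ}

lemma summable_norm_fourierCoeffX_shift (hK : IsGlobalSymbol m δ K) (hħ : ħ ∈ Ioc (0 : ℝ) 1)
    (ξ : Momentum d) :
    Summable fun k => ‖fourierCoeffX (K ħ) (-k) (ξ + ħ • toVec k)‖ := by
  obtain ⟨N, hN⟩ := exists_summable_weight d
  obtain ⟨C, -, hC⟩ := exists_fourierCoeffX_decay hK 0 N
  refine (hN.mul_left (C * ħ ^ (m - δ * (0 : ℕ)))).of_nonneg_of_le (fun k => norm_nonneg _)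
    fun k => ?_
  rw [← div_eq_mul_inv, le_div_iff₀ (pow_pos (weight_pos k) N), mul_comm]
  simpa [weight_neg] using hC ħ hħ (-k) (ξ + ħ • toVec k)

/-- An adjoint is by definition a Fourier series, so self-adjointness represents `K` by such a
series without a separate Fourier inversion. -/
lemma IsSelfAdjointSymbol.eq_tsum (hKsa : IsSelfAdjointSymbol K) (hħ : ħ ∈ Ioc (0 : ℝ) 1) :
    K ħ = fun x ξ => ∑' k : FourierLattice d,
      (starRingEnd ℂ) (fourierCoeffX (K ħ) (-k) (ξ + ħ • toVec k)) * expChar k x := by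
  ext x ξ
  rw [← adjointSymbol_eq_tsum, hKsa ħ hħ]

/-- Self-adjointness in terms of the Fourier coefficients. -/
lemma IsSelfAdjointSymbol.conj_fourierCoeffX (hKsa : IsSelfAdjointSymbol K)
    (hK : IsGlobalSymbol m δ K) (hħ : ħ ∈ Ioc (0 : ℝ) 1) (k : FourierLattice d) (ξ : Momentum d) :
    (starRingEnd ℂ) (fourierCoeffX (K ħ) (-k) (ξ + ħ • toVec k)) = fourierCoeffX (K ħ) k ξ := by
  conv_rhs => rw [hKsa.eq_tsum hħ]
  rw [fourierCoeffX_tsum (g := fun k ξ =>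
    (starRingEnd ℂ) (fourierCoeffX (K ħ) (-k) (ξ + ħ • toVec k)))]
  simpa using summable_norm_fourierCoeffX_shift hK hħ ξ

/-- A self-adjoint symbol is the sum of its Fourier series. -/
lemma IsSelfAdjointSymbol.eq_multiplierSymbol (hKsa : IsSelfAdjointSymbol K)
    (hK : IsGlobalSymbol m δ K) (hħ : ħ ∈ Ioc (0 : ℝ) 1) (x : Fin d → ℝ) (ξ : Momentum d) :
    K ħ x ξ = multiplierSymbol (fun _ _ _ => 1) K ħ x ξ := by
  conv_lhs => rw [hKsa.eq_tsum hħ]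
  simp only [multiplierSymbol, one_mul, hKsa.conj_fourierCoeffX hK hħ]

variable {c c' : ℝ → FourierLattice d → Momentum d → ℂ}

lemma IsMultiplier.fourierCoeffX_multiplierSymbol (hc : IsMultiplier δ c)
    (hK : IsGlobalSymbol m δ K) (hħ : ħ ∈ Ioc (0 : ℝ) 1) (k : FourierLattice d) (ξ : Momentum d) :
    fourierCoeffX (multiplierSymbol c K ħ) k ξ = c ħ k ξ * fourierCoeffX (K ħ) k ξ :=
  fourierCoeffX_tsum (g := fun k ξ => c ħ k ξ * fourierCoeffX (K ħ) k ξ)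
    ((hc.isRapidlyDecreasing hK hħ).summable_norm ξ) k

/-- The multipliers of the adjoint symbol. -/
def adjointMultiplier (c : ℝ → FourierLattice d → Momentum d → ℂ) :
    ℝ → FourierLattice d → Momentum d → ℂ :=
  fun ħ k ξ => (starRingEnd ℂ) (c ħ (-k) (ξ + ħ • toVec k))

/-- The conjugated and shifted coefficient of $K$ is again $\tilde K(k,\xi)$, so only the multiplier
changes. -/
lemma IsMultiplier.adjointSymbol_multiplierSymbol (hc : IsMultiplier δ c)
    (hK : IsGlobalSymbol m δ K) (hKsa : IsSelfAdjointSymbol K) (hħ : ħ ∈ Ioc (0 : ℝ) 1)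
    (x : Fin d → ℝ) (ξ : Momentum d) :
    adjointSymbol (multiplierSymbol c K) ħ x ξ =
      multiplierSymbol (adjointMultiplier c) K ħ x ξ := by
  rw [adjointSymbol_eq_tsum]
  refine tsum_congr fun k => ?_
  rw [hc.fourierCoeffX_multiplierSymbol hK hħ, map_mul, hKsa.conj_fourierCoeffX hK hħ]
  rfl

lemma IsMultiplier.summable (hc : IsMultiplier δ c) (hK : IsGlobalSymbol m δ K)
    (hħ : ħ ∈ Ioc (0 : ℝ) 1) (x : Fin d → ℝ) (ξ : Momentum d) :
    Summable fun k => c ħ k ξ * fourierCoeffX (K ħ) k ξ * expChar k x := by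
  refine Summable.of_norm ?_
  simpa [norm_expChar] using (hc.isRapidlyDecreasing hK hħ).summable_norm ξ

lemma multiplierSymbol_add (hc : IsMultiplier δ c) (hc' : IsMultiplier δ c')
    (hK : IsGlobalSymbol m δ K) (hħ : ħ ∈ Ioc (0 : ℝ) 1) (x : Fin d → ℝ) (ξ : Momentum d) :
    multiplierSymbol (fun ħ k ξ => c ħ k ξ + c' ħ k ξ) K ħ x ξ =
      multiplierSymbol c K ħ x ξ + multiplierSymbol c' K ħ x ξ := by
  rw [multiplierSymbol, multiplierSymbol, multiplierSymbol,
    ← (hc.summable hK hħ x ξ).tsum_add (hc'.summable hK hħ x ξ)]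
  simp only [add_mul]

lemma multiplierSymbol_sub (hc : IsMultiplier δ c) (hc' : IsMultiplier δ c')
    (hK : IsGlobalSymbol m δ K) (hħ : ħ ∈ Ioc (0 : ℝ) 1) (x : Fin d → ℝ) (ξ : Momentum d) :
    multiplierSymbol (fun ħ k ξ => c ħ k ξ - c' ħ k ξ) K ħ x ξ =
      multiplierSymbol c K ħ x ξ - multiplierSymbol c' K ħ x ξ := by
  rw [multiplierSymbol, multiplierSymbol, multiplierSymbol,
    ← (hc.summable hK hħ x ξ).tsum_sub (hc'.summable hK hħ x ξ)]
  simp only [sub_mul]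

lemma multiplierSymbol_const_mul (a : ℂ) (x : Fin d → ℝ) (ξ : Momentum d) :
    multiplierSymbol (fun ħ k ξ => a * c ħ k ξ) K ħ x ξ = a * multiplierSymbol c K ħ x ξ := by
  rw [multiplierSymbol, multiplierSymbol, ← tsum_mul_left]
  simp only [mul_assoc]

end SelfAdjoint

/-! ### Lattice averages -/

/-- The saturation `ℝ.R ∩ ℤ^d` of a lattice, defined as its double annihilator. -/
def saturation (R : Sublattice d) : Sublattice d := annihilatorLattice (annihilatorLattice R)

/-- The exponents of `e^{i k · x}` along the basis of the annihilator of `R`. -/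
def averageIndex (R : Sublattice d) (k : FourierLattice d) :
    FourierLattice (Module.finrank ℤ (annihilatorLattice R)) :=
  fun j => ∑ i, (Module.finBasis ℤ (annihilatorLattice R) j : FourierLattice d) i * k i

/-- Orthogonality to a basis of the annihilator is orthogonality to all of it. -/
lemma averageIndex_eq_zero_iff (R : Sublattice d) (k : FourierLattice d) :
    averageIndex R k = 0 ↔ k ∈ saturation R := by
  constructor
  · intro h n hn
    have h1 := congrArg Subtype.val ((Module.finBasis ℤ (annihilatorLattice R)).sum_repr ⟨n, hn⟩)
    simp only [Submodule.coe_sum, Submodule.coe_smul] at h1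
    rw [← h1]
    simp only [Finset.sum_apply, Pi.smul_apply, smul_eq_mul, Finset.sum_mul]
    rw [Finset.sum_comm]
    refine Finset.sum_eq_zero fun j _ => ?_
    have := congrFun h j
    simp only [averageIndex, Pi.zero_apply] at this
    simp only [mul_assoc, ← Finset.mul_sum, this, mul_zero]
  · intro h
    ext j
    exact h _ (Module.finBasis ℤ (annihilatorLattice R) j).2

lemma expChar_average_shift (R : Sublattice d) (k : FourierLattice d) (x : Fin d → ℝ)
    (t : Fin (Module.finrank ℤ (annihilatorLattice R)) → ℝ) :
    expChar k (fun i => x i + ∑ j, t j * (2 * Real.pi *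
      (((Module.finBasis ℤ (annihilatorLattice R) j : FourierLattice d) i : ℤ) : ℝ))) =
      expChar k x * expChar (averageIndex R k) ((2 * Real.pi) • t) := by
  have h : pairing k (fun i => x i + ∑ j, t j * (2 * Real.pi *
      (((Module.finBasis ℤ (annihilatorLattice R) j : FourierLattice d) i : ℤ) : ℝ))) =
      pairing k x + pairing (averageIndex R k) ((2 * Real.pi) • t) := by
    simp only [pairing, averageIndex, mul_add, Finset.sum_add_distrib, Finset.mul_sum,
      Int.cast_sum, Int.cast_mul, Finset.sum_mul, Pi.smul_apply, smul_eq_mul]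
    congr 1
    rw [Finset.sum_comm]
    exact Finset.sum_congr rfl fun j _ => Finset.sum_congr rfl fun i _ => by ring
  simp [expChar, h, mul_add, Complex.exp_add]

lemma integral_unitCube_expChar {p : ℕ} {n : FourierLattice p} (hn : n ≠ 0) :
    ∫ t in Icc (0 : Fin p → ℝ) 1, expChar n ((2 * Real.pi) • t) = 0 := by
  obtain ⟨j, hj⟩ := Function.ne_iff.1 hn
  have h := setIntegral_cube_add one_pos (fun t : Fin p → ℝ => expChar n ((2 * Real.pi) • t))
    (fun l t => by
      rw [← expChar_periodic n l ((2 * Real.pi) • t)]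
      congr 1
      ext i
      -- The half-period translation again, rescaled to the unit cube: the integral equals its own
      -- negative.
      simp [mul_add]) ((2 * Real.pi)⁻¹ • halfShift n j)
  simp only [smul_add, expChar_add, smul_inv_smul₀ Real.two_pi_pos.ne', expChar_halfShift hj,
    mul_neg, mul_one, integral_neg] at h
  exact self_eq_neg.1 h.symm

open scoped Classical in
/-- The restriction of multipliers to the saturations of the lattices `R ħ`. -/
def restrictMultiplier (R : ℝ → Sublattice d) (c : ℝ → FourierLattice d → Momentum d → ℂ) :
    ℝ → FourierLattice d → Momentum d → ℂ :=
  fun ħ k ξ => if k ∈ saturation (R ħ) then c ħ k ξ else 0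

/-- Along the torus directions of the annihilator, $e^{ik\cdot x}$ becomes a character of index
`averageIndex`. Its mean is $1$ for index zero, that is for $k$ in the saturation, and $0$
otherwise. -/
lemma IsMultiplier.latticeAverage_multiplierSymbol {m δ : ℝ} {K : Family d} {ħ : ℝ}
    {c : ℝ → FourierLattice d → Momentum d → ℂ} (hc : IsMultiplier δ c)
    (hK : IsGlobalSymbol m δ K) (hħ : ħ ∈ Ioc (0 : ℝ) 1) (R : ℝ → Sublattice d)
    (x : Fin d → ℝ) (ξ : Momentum d) :
    latticeAverage (R ħ) (multiplierSymbol c K ħ) x ξ =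
      multiplierSymbol (restrictMultiplier R c) K ħ x ξ := by
  have hg := (hc.isRapidlyDecreasing hK hħ).summable_norm ξ
  set g : FourierLattice d → ℂ := fun k => c ħ k ξ * fourierCoeffX (K ħ) k ξ
  have hcont : ∀ k, Continuous fun t => expChar (averageIndex (R ħ) k) ((2 * Real.pi) • t) :=
    fun k => (continuous_expChar _).comp (continuous_const_smul _)
  simp only [latticeAverage, multiplierSymbol, expChar_average_shift]
  rw [← integral_tsum_of_summable_integral_norm
    (F := fun k t => g k * (expChar k x * expChar (averageIndex (R ħ) k) ((2 * Real.pi) • t)))]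
  · refine tsum_congr fun k => ?_
    rw [integral_const_mul, integral_const_mul, restrictMultiplier]
    split_ifs with hk
    · rw [(averageIndex_eq_zero_iff _ _).2 hk]
      simp only [expChar_zero_left]
      rw [setIntegral_const, Measure.real, Real.volume_Icc_pi_toReal (by intro i; simp)]
      simp [g]
    · rw [integral_unitCube_expChar (fun h => hk ((averageIndex_eq_zero_iff _ _).1 h))]
      simp
  · exact fun k => ((continuous_const.mul
      (continuous_const.mul (hcont k))).continuousOn).integrableOn_compact isCompact_Icc
  · simp only [norm_mul, norm_expChar, mul_one, setIntegral_const]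
    have hg' : Summable fun k => ‖c ħ k ξ * fourierCoeffX (K ħ) k ξ‖ := hg
    simp only [norm_mul] at hg'
    simpa only [g, norm_mul] using hg'.const_smul _

variable {d : ℕ}

/-! ### Truncation functions -/

lemma norm_iteratedFDeriv_ofReal {E : Type*} [NormedAddCommGroup E] [NormedSpace ℝ E] {f : E → ℝ}
    (hf : ContDiff ℝ ∞ f) (n : ℕ) (x : E) :
    ‖iteratedFDeriv ℝ n (fun y => (f y : ℂ)) x‖ = ‖iteratedFDeriv ℝ n f x‖ :=
  Complex.ofRealLI.norm_iteratedFDeriv_comp_left hf.contDiffAt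
    (by exact_mod_cast le_top : (n : WithTop ℕ∞) ≤ ∞)

/-- A smooth function with bounded derivatives that is flat at `0` is small near `0` to all
orders. -/
lemma exists_norm_iteratedFDeriv_le_pow_of_flat {f : ℝ → ℝ} (hf : ContDiff ℝ ∞ f)
    (hb : ∀ i : ℕ, ∃ C : ℝ, ∀ t, ‖iteratedFDeriv ℝ i f t‖ ≤ C)
    (h0 : ∀ i : ℕ, iteratedFDeriv ℝ i f 0 = 0) (N : ℕ) :
    ∀ i : ℕ, ∃ C : ℝ, ∀ t, ‖iteratedFDeriv ℝ i f t‖ ≤ C * |t| ^ N := by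
  induction N with
  | zero => simpa using hb
  | succ N ih =>
    intro i
    -- The bound $C|y|^N$ for the next derivative is at most $C|t|^N$ on the ball $|y|\le|t|$; the
    -- mean value inequality from $0$, where the `i`-th derivative vanishes, supplies the extra
    -- factor $|t|$.
    obtain ⟨C, hC⟩ := ih (i + 1)
    refine ⟨C, fun t => ?_⟩
    have hC0 : 0 ≤ C := by
      have := (norm_nonneg _).trans (hC 1)
      simpa using this
    have h := Convex.norm_image_sub_le_of_norm_fderiv_le (𝕜 := ℝ) (f := iteratedFDeriv ℝ i f)
      (s := Metric.closedBall 0 |t|) (C := C * |t| ^ N) (x := 0) (y := t)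
      (fun y _ => (hf.differentiable_iteratedFDeriv (by exact_mod_cast WithTop.coe_lt_top i)) y)
      (fun y hy => by
        rw [norm_fderiv_iteratedFDeriv]
        refine (hC y).trans ?_
        have : |y| ≤ |t| := by simpa using hy
        gcongr)
      (convex_closedBall _ _) (by simp) (by simp)
    rw [h0, sub_zero, sub_zero, Real.norm_eq_abs] at h
    rw [pow_succ, ← mul_assoc]
    exact h

namespace IsTruncation

variable {χ : ℝ → ℝ}

lemma exists_bound (hχ : IsTruncation χ) (i : ℕ) :
    ∃ C : ℝ, ∀ t, ‖iteratedFDeriv ℝ i χ t‖ ≤ C := by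
  have hs : HasCompactSupport χ := HasCompactSupport.intro (isCompact_Icc (a := (-1 : ℝ)) (b := 1))
    fun t ht => hχ.vanish t (by
      by_contra h
      exact ht (abs_le.1 (not_le.1 h).le))
  exact (hs.iteratedFDeriv i).exists_bound_of_continuous
    (hχ.smooth.continuous_iteratedFDeriv (by exact_mod_cast le_top))

lemma iteratedFDeriv_eq_zero (hχ : IsTruncation χ) (i : ℕ) {t : ℝ} (ht : 1 < |t|) :
    iteratedFDeriv ℝ i χ t = 0 := by
  have h : χ =ᶠ[nhds t] fun _ => 0 := by
    filter_upwards [(isOpen_lt continuous_const continuous_abs).mem_nhds ht] with s hs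
    exact hχ.vanish s (le_of_lt hs)
  rw [(h.iteratedFDeriv ℝ i).eq_of_nhds]
  simp

lemma exists_bound_sub_one (hχ : IsTruncation χ) (i N : ℕ) :
    ∃ C : ℝ, ∀ t, ‖iteratedFDeriv ℝ i (fun t => χ t - 1) t‖ ≤ C * |t| ^ N := by
  have hsm : ContDiff ℝ ∞ fun t => χ t - 1 := hχ.smooth.sub contDiff_const
  refine exists_norm_iteratedFDeriv_le_pow_of_flat hsm (fun i => ?_) (fun i => ?_) N i
  · obtain ⟨C, hC⟩ := hχ.exists_bound i
    refine ⟨C + 1, fun t => ?_⟩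
    have e : iteratedFDeriv ℝ i (fun t => χ t - 1) t =
        iteratedFDeriv ℝ i χ t - iteratedFDeriv ℝ i (fun _ => (1 : ℝ)) t :=
      iteratedFDeriv_sub_apply (hχ.smooth.contDiffAt.of_le (by exact_mod_cast le_top))
        contDiff_const.contDiffAt
    have h1 : ‖iteratedFDeriv ℝ i (fun _ : ℝ => (1 : ℝ)) t‖ ≤ 1 := by
      rcases Nat.eq_zero_or_pos i with rfl | hi
      · simp
      · rw [iteratedFDeriv_const_of_ne hi.ne']
        simp
    rw [e]
    exact (norm_sub_le _ _).trans (add_le_add (hC t) h1)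
  · have := norm_iteratedFDeriv_eq_norm_iteratedDeriv (𝕜 := ℝ) (n := i)
      (f := fun t => χ t - 1) (x := 0)
    rw [hχ.flat i, norm_zero, norm_eq_zero] at this
    exact this

end IsTruncation

/-! ### The phase functions -/

/-- `H` is smooth and all its derivatives are bounded. -/
structure HasBoundedDerivs (H : Momentum d → ℝ) : Prop where
  smooth : ContDiff ℝ ∞ H
  bound : ∀ b : ℕ, ∃ C : ℝ, ∀ ξ, ‖iteratedFDeriv ℝ b H ξ‖ ≤ C

lemma hasBoundedDerivs_of_isGlobalSymbol {H : Momentum d → ℝ}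
    (hH : IsGlobalSymbol 0 0 (fun _ _ ξ => ((H ξ : ℝ) : ℂ) : Family d)) : HasBoundedDerivs H := by
  have hsm : ContDiff ℝ ∞ H :=
    Complex.reCLM.contDiff.comp
      (contDiff_apply_left (F := fun _ ξ => ((H ξ : ℝ) : ℂ)) (hH.1 1 ⟨one_pos, le_rfl⟩).1 0)
  refine ⟨hsm, fun b => ?_⟩
  obtain ⟨C, -, hC⟩ := hH.2 0 b
  refine ⟨C, fun ξ => ?_⟩
  -- The family depends on neither $\hbar$ nor $x$, so the values $\hbar=1$, $x=0$ retain all the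
  -- information.
  have := hC 1 ⟨one_pos, le_rfl⟩ 0 ξ trivial
  rw [norm_iteratedFDeriv_zero, norm_iteratedFDeriv_ofReal hsm] at this
  simpa using this

/-- The argument `Ω_k(ξ + s ħ k) / (|k| ħ^δ)` of the truncation function. -/
def phase (H : Momentum d → ℝ) (δ s ħ : ℝ) (k : FourierLattice d) (ξ : Momentum d) : ℝ :=
  Omega H (toVec k) (ξ + (s * ħ) • toVec k) / (‖toVec k‖ * ħ ^ δ)

namespace HasBoundedDerivs

variable {H : Momentum d → ℝ}

lemma contDiff_phase (hH : HasBoundedDerivs H) (δ s ħ : ℝ) (k : FourierLattice d) :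
    ContDiff ℝ ∞ (phase H δ s ħ k) :=
  (((hH.smooth.fderiv_right (m := ∞) (by exact_mod_cast le_top)).comp
    (contDiff_id.add contDiff_const)).clm_apply contDiff_const).div_const _

/-- The phase is linear in the direction $k$ and divided by $|k|$, so the bounds are uniform in $k$.
Derivatives in $\xi$ fall on $H$ only, hence a single factor $\hbar^{-\delta}$ at every order. -/
lemma exists_norm_iteratedFDeriv_phase_le (hH : HasBoundedDerivs H) (δ : ℝ) (i : ℕ) :
    ∃ C : ℝ, 0 < C ∧ ∀ ħ ∈ Ioc (0 : ℝ) 1, ∀ s k ξ,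
      ‖iteratedFDeriv ℝ i (phase H δ s ħ k) ξ‖ ≤ C * ħ ^ (-δ) := by
  obtain ⟨C, hC⟩ := hH.bound (i + 1)
  have hC0 : 0 ≤ C := (norm_nonneg _).trans (hC 0)
  refine ⟨C + 1, by positivity, fun ħ hħ s k ξ => ?_⟩
  have hħδ := Real.rpow_pos_of_pos hħ.1 δ
  set v := (s * ħ) • toVec k
  have hsm : ContDiff ℝ ∞ fun η => fderiv ℝ H (η + v) :=
    (hH.smooth.fderiv_right (m := ∞) (by exact_mod_cast le_top)).comp
      (contDiff_id.add contDiff_const)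
  have e : phase H δ s ħ k = (‖toVec k‖ * ħ ^ δ)⁻¹ • fun η => fderiv ℝ H (η + v) (toVec k) := by
    ext η
    simp only [phase, Omega, Pi.smul_apply, smul_eq_mul]
    rw [div_eq_inv_mul]
  have h1 : ‖iteratedFDeriv ℝ i (fun η => fderiv ℝ H (η + v) (toVec k)) ξ‖ ≤ ‖toVec k‖ * C := by
    refine (norm_iteratedFDeriv_clm_apply_const (N := ∞) hsm.contDiffAt
      (by exact_mod_cast le_top)).trans ?_
    rw [iteratedFDeriv_comp_add_right (f := fderiv ℝ H), norm_iteratedFDeriv_fderiv]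
    gcongr
    exact hC _
  rw [e, iteratedFDeriv_const_smul_apply
    ((hsm.clm_apply contDiff_const).contDiffAt.of_le (by exact_mod_cast le_top)), norm_smul,
    Real.norm_of_nonneg (by positivity), mul_inv, Real.rpow_neg hħ.1.le]
  calc _ ≤ ‖toVec k‖⁻¹ * (ħ ^ δ)⁻¹ * (‖toVec k‖ * C) := by gcongr
    _ = (‖toVec k‖⁻¹ * ‖toVec k‖) * (C * (ħ ^ δ)⁻¹) := by ring
    _ ≤ 1 * ((C + 1) * (ħ ^ δ)⁻¹) := by
        gcongr
        · exact inv_mul_le_one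
        · linarith
    _ = _ := one_mul _

/-- Derivatives of functions of the phase. -/
lemma exists_norm_iteratedFDeriv_comp_phase_le (hH : HasBoundedDerivs H) {δ : ℝ} (hδ : 0 < δ)
    (b : ℕ) : ∃ B : ℝ, 0 < B ∧ ∀ ħ ∈ Ioc (0 : ℝ) 1, ∀ s k ξ, ∀ φ : ℝ → ℝ, ContDiff ℝ ∞ φ →
      ∀ C : ℝ, (∀ i ≤ b, ‖iteratedFDeriv ℝ i φ (phase H δ s ħ k ξ)‖ ≤ C) →
      ‖iteratedFDeriv ℝ b (fun η => φ (phase H δ s ħ k η)) ξ‖ ≤ B * C * ħ ^ (-(δ * b)) := by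
  choose D hD hDb using hH.exists_norm_iteratedFDeriv_phase_le δ
  set A := 1 + ∑ i ∈ Finset.range (b + 1), D i
  have hA1 : 1 ≤ A := by
    have := Finset.sum_nonneg fun i (_ : i ∈ Finset.range (b + 1)) => (hD i).le
    simp only [A]
    linarith
  refine ⟨b.factorial * A ^ b, by positivity, fun ħ hħ s k ξ φ hφ C hC => ?_⟩
  have h1 : 1 ≤ ħ ^ (-δ) := Real.one_le_rpow_of_pos_of_le_one_of_nonpos hħ.1 hħ.2 (by linarith)
  have hA2 : 1 ≤ A * ħ ^ (-δ) := one_le_mul_of_one_le_of_one_le hA1 h1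
  have := norm_iteratedFDeriv_comp_le (𝕜 := ℝ) (N := ∞) (n := b) hφ
    (hH.contDiff_phase δ s ħ k) (by exact_mod_cast le_top) ξ hC (D := A * ħ ^ (-δ))
    (fun i hi hib => by
      refine (hDb i ħ hħ s k ξ).trans ((?_ : _ ≤ A * ħ ^ (-δ)).trans
        (le_self_pow₀ hA2 (by omega)))
      have : D i ≤ ∑ i ∈ Finset.range (b + 1), D i :=
        Finset.single_le_sum (fun i _ => (hD i).le) (Finset.mem_range.2 (Nat.lt_succ_of_le hib))
      gcongr
      simp only [A]
      linarith)
  refine this.trans (le_of_eq ?_)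
  rw [mul_pow, ← Real.rpow_natCast (ħ ^ (-δ)), ← Real.rpow_mul hħ.1.le, neg_mul]
  ring

end HasBoundedDerivs

/-! ### The truncation at large and at small phases. -/

section PhaseBounds

variable {H : Momentum d → ℝ} {χ : ℝ → ℝ} {δ : ℝ}

lemma exists_uniform_bound {ι : Type*} (b : ℕ) {F : ℕ → ι → ℝ}
    (h : ∀ i : ℕ, ∃ C : ℝ, ∀ t, F i t ≤ C) : ∃ C : ℝ, 0 < C ∧ ∀ i ≤ b, ∀ t, F i t ≤ C := by
  choose C hC using h
  refine ⟨1 + ∑ i ∈ Finset.range (b + 1), |C i|, by positivity, fun i hi t => ?_⟩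
  have : |C i| ≤ ∑ i ∈ Finset.range (b + 1), |C i| :=
    Finset.single_le_sum (f := fun i => |C i|) (fun i _ => abs_nonneg _)
      (Finset.mem_range.2 (Nat.lt_succ_of_le hi))
  linarith [hC i t, le_abs_self (C i)]

lemma IsTruncation.exists_norm_comp_phase_le (hχ : IsTruncation χ) (hH : HasBoundedDerivs H)
    (hδ : 0 < δ) (b : ℕ) : ∃ C : ℝ, 0 < C ∧ ∀ ħ ∈ Ioc (0 : ℝ) 1, ∀ s k ξ,
      ‖iteratedFDeriv ℝ b (fun η => χ (phase H δ s ħ k η)) ξ‖ ≤ C * ħ ^ (-(δ * b)) := by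
  obtain ⟨B, hB, hBb⟩ := hH.exists_norm_iteratedFDeriv_comp_phase_le hδ b
  obtain ⟨C, hC, hCb⟩ := exists_uniform_bound b hχ.exists_bound
  exact ⟨B * C, by positivity, fun ħ hħ s k ξ =>
    hBb ħ hħ s k ξ χ hχ.smooth C fun i hi => hCb i hi _⟩

/-- A large power of `ħ^ε` beats any power of `ħ`. -/
lemma exists_nat_rpow_le {ε : ℝ} (hε : 0 < ε) (M : ℝ) :
    ∃ N : ℕ, ∀ ħ ∈ Ioc (0 : ℝ) 1, (ħ ^ ε) ^ N ≤ ħ ^ M := by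
  obtain ⟨N, hN⟩ := exists_nat_ge (M / ε)
  refine ⟨N, fun ħ hħ => ?_⟩
  rw [← Real.rpow_natCast, ← Real.rpow_mul hħ.1.le]
  refine Real.rpow_le_rpow_of_exponent_ge hħ.1 hħ.2 ?_
  rw [div_le_iff₀ hε] at hN
  linarith

/-- The truncation is negligible where the phase is large. -/
lemma IsTruncation.exists_norm_comp_phase_le_of_large (hχ : IsTruncation χ)
    (hH : HasBoundedDerivs H) (hδ : 0 < δ) {A ε : ℝ} (hA : 0 < A) (hε : 0 < ε) (M : ℝ) (b : ℕ) :
    ∃ (C : ℝ) (p : ℕ), 0 < C ∧ ∀ ħ ∈ Ioc (0 : ℝ) 1, ∀ s k ξ,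
      (1 < |phase H δ s ħ k ξ| ∨ 1 ≤ A * weight k * ħ ^ ε) →
      ‖iteratedFDeriv ℝ b (fun η => χ (phase H δ s ħ k η)) ξ‖ ≤
        C * weight k ^ p * ħ ^ (M - δ * b) := by
  obtain ⟨B, hB, hBb⟩ := hH.exists_norm_iteratedFDeriv_comp_phase_le hδ b
  obtain ⟨C, hC, hCb⟩ := hχ.exists_norm_comp_phase_le hH hδ b
  obtain ⟨N, hN⟩ := exists_nat_rpow_le hε M
  refine ⟨C * A ^ N, N, by positivity, fun ħ hħ s k ξ h => ?_⟩
  have hw := weight_pos k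
  have hħ0 := hħ.1
  rcases h with h | h
  · have := hBb ħ hħ s k ξ χ hχ.smooth 0 fun i _ => by
      rw [hχ.iteratedFDeriv_eq_zero i h, norm_zero]
    rw [mul_zero, zero_mul] at this
    exact this.trans (by positivity)
  · refine (hCb ħ hħ s k ξ).trans ?_
    -- Multiplying by this factor trades powers of the weight for the power $\hbar^M$.
    have h1 : 1 ≤ (A * weight k * ħ ^ ε) ^ N := one_le_pow₀ h
    calc _ = C * ħ ^ (-(δ * b)) * 1 := by ring
      _ ≤ C * ħ ^ (-(δ * b)) * (A * weight k * ħ ^ ε) ^ N := by gcongr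
      _ = C * A ^ N * weight k ^ N * ((ħ ^ ε) ^ N * ħ ^ (-(δ * b))) := by ring
      _ ≤ C * A ^ N * weight k ^ N * (ħ ^ M * ħ ^ (-(δ * b))) := by
          gcongr
          exact hN ħ hħ
      _ = _ := by rw [← Real.rpow_add hħ0, sub_eq_add_neg]

/-- The truncation is negligibly different from `1` where the phase is small. -/
lemma IsTruncation.exists_norm_comp_phase_sub_one_le_of_small (hχ : IsTruncation χ)
    (hH : HasBoundedDerivs H) (hδ : 0 < δ) {A ε : ℝ} (hA : 0 < A) (hε : 0 < ε) (M : ℝ) (b : ℕ) :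
    ∃ (C : ℝ) (p : ℕ), 0 < C ∧ ∀ ħ ∈ Ioc (0 : ℝ) 1, ∀ s k ξ,
      |phase H δ s ħ k ξ| ≤ A * weight k * ħ ^ ε →
      ‖iteratedFDeriv ℝ b (fun η => χ (phase H δ s ħ k η) - 1) ξ‖ ≤
        C * weight k ^ p * ħ ^ (M - δ * b) := by
  obtain ⟨B, hB, hBb⟩ := hH.exists_norm_iteratedFDeriv_comp_phase_le hδ b
  obtain ⟨N, hN⟩ := exists_nat_rpow_le hε M
  -- The order of flatness used is the `N` for which $\hbar^{\varepsilon N}\le\hbar^M$.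
  choose D hD using fun i => hχ.exists_bound_sub_one i N
  set C := 1 + ∑ i ∈ Finset.range (b + 1), |D i|
  have hC : 0 < C := by positivity
  refine ⟨B * (C * A ^ N), N, by positivity, fun ħ hħ s k ξ h => ?_⟩
  have hw := weight_pos k
  have hħ0 := hħ.1
  refine (hBb ħ hħ s k ξ _ (hχ.smooth.sub contDiff_const)
    (C * (A * weight k * ħ ^ ε) ^ N) fun i hi => ?_).trans ?_
  · refine (hD i _).trans ?_
    have h1 : |D i| ≤ ∑ i ∈ Finset.range (b + 1), |D i| :=
      Finset.single_le_sum (f := fun i => |D i|) (fun i _ => abs_nonneg _)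
        (Finset.mem_range.2 (Nat.lt_succ_of_le hi))
    have h2 : D i ≤ C := by linarith [le_abs_self (D i)]
    gcongr
  · calc _ = B * (C * A ^ N) * weight k ^ N * ((ħ ^ ε) ^ N * ħ ^ (-(δ * b))) := by ring
      _ ≤ B * (C * A ^ N) * weight k ^ N * (ħ ^ M * ħ ^ (-(δ * b))) := by
          gcongr
          exact hN ħ hħ
      _ = _ := by rw [← Real.rpow_add hħ0, sub_eq_add_neg]

end PhaseBounds

variable {d : ℕ}

/-! ### Gram determinants -/

section Gram

variable {E : Type*} [NormedAddCommGroup E] [InnerProductSpace ℝ E]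

/-- Subtracting combinations of the other rows replaces `k` by `u` in the first row of the Gram
matrix. As $u$ is orthogonal to the $v_j$ and $\langle u,k\rangle=|u|^2$, that row becomes
$(|u|^2,0,\dots,0)$. -/
lemma det_gram_cons {n : ℕ} (v : Fin n → E) (k u : E) (hku : k - u ∈ Submodule.span ℝ (range v))
    (hu : ∀ j, inner ℝ u (v j) = 0) :
    (Matrix.gram ℝ (Fin.cons k v : Fin (n + 1) → E)).det =
      ‖u‖ ^ 2 * (Matrix.gram ℝ v).det := by
  obtain ⟨c, hc⟩ := (Submodule.mem_span_range_iff_exists_fun ℝ).1 hku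
  have huk : u = k - ∑ i, c i • v i := by rw [hc]; abel
  have huu : inner ℝ u k = ‖u‖ ^ 2 := by
    have : k = u + ∑ i, c i • v i := by rw [hc]; abel
    rw [this, inner_add_right, inner_sum, real_inner_self_eq_norm_sq]
    simp [inner_smul_right, hu]
  set A := Matrix.gram ℝ (Fin.cons k v : Fin (n + 1) → E)
  have h := Matrix.det_updateRow_sum A 0 (Fin.cons 1 fun i => -c i)
  rw [Fin.cons_zero, one_smul] at h
  have hrow : (∑ l : Fin (n + 1), (Fin.cons 1 fun i => -c i : Fin (n + 1) → ℝ) l • A l) =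
      fun j => inner ℝ u ((Fin.cons k v : Fin (n + 1) → E) j) := by
    ext j
    rw [huk, inner_sub_left, sum_inner]
    simp [A, Fin.sum_univ_succ, Matrix.gram_apply, inner_smul_left, sub_eq_add_neg]
  rw [hrow] at h
  rw [← h, Matrix.det_succ_row_zero, Fin.sum_univ_succ]
  have hsub : (A.updateRow 0 fun j => inner ℝ u ((Fin.cons k v : Fin (n + 1) → E) j)).submatrix
      Fin.succ (Fin.succAbove 0) = Matrix.gram ℝ v := by
    ext i j
    simp [A, Matrix.gram_apply]
  rw [hsub]
  simp [Matrix.updateRow_self, hu, huu]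

lemma det_gram_nonneg {n : ℕ} (v : Fin n → E) : 0 ≤ (Matrix.gram ℝ v).det :=
  (Matrix.posSemidef_gram ℝ v).det_nonneg

lemma exists_orthogonal_decomposition {n : ℕ} (v : Fin n → E) (k : E) :
    ∃ u : E, k - u ∈ Submodule.span ℝ (range v) ∧
      ∀ y ∈ Submodule.span ℝ (range v), inner ℝ u y = 0 := by
  have : FiniteDimensional ℝ (Submodule.span ℝ (range v)) :=
    FiniteDimensional.span_of_finite ℝ (finite_range v)
  set V := Submodule.span ℝ (range v)
  refine ⟨k - V.starProjection k, ?_, fun y hy => ?_⟩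
  · rw [sub_sub_cancel]
    exact V.starProjection_apply_mem k
  · rw [real_inner_comm]
    exact (Submodule.mem_orthogonal V _).1 (V.sub_starProjection_mem_orthogonal k) y hy

lemma norm_sq_eq_of_decomposition {k u : E} (h : inner ℝ u (k - u) = 0) :
    ‖k‖ ^ 2 = ‖u‖ ^ 2 + ‖k - u‖ ^ 2 := by
  have := norm_add_sq_eq_norm_sq_add_norm_sq_of_inner_eq_zero u (k - u) h
  rw [add_sub_cancel] at this
  nlinarith

/-- Hadamard's inequality. -/
lemma det_gram_le {n : ℕ} (v : Fin n → E) : (Matrix.gram ℝ v).det ≤ ∏ i, ‖v i‖ ^ 2 := by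
  induction n with
  | zero => simp
  | succ n ih =>
    obtain ⟨u, hu, hort⟩ := exists_orthogonal_decomposition (Fin.tail v) (v 0)
    have h := det_gram_cons (Fin.tail v) (v 0) u hu
      fun j => hort _ (Submodule.subset_span ⟨j, rfl⟩)
    rw [Fin.cons_self_tail] at h
    rw [h, Fin.prod_univ_succ]
    have h1 := norm_sq_eq_of_decomposition (hort _ hu)
    exact mul_le_mul (by nlinarith [sq_nonneg ‖v 0 - u‖]) (ih _) (det_gram_nonneg _)
      (sq_nonneg _)

/-- A linear form that is small on a subspace but large somewhere on the span of the subspace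
and `k` is large at `k`. -/
lemma lower_bound_of_large_on_span (V : Submodule ℝ E) (Ω : E →ₗ[ℝ] ℝ) {k u X : E}
    (hku : k - u ∈ V) (hu : ∀ y ∈ V, inner ℝ u y = 0) {T₀ T₁ : ℝ} (hT₀ : 0 ≤ T₀)
    (hV : ∀ y ∈ V, |Ω y| ≤ T₀ * ‖y‖) (hX0 : X ≠ 0) {Y : E} {t : ℝ} (hY : Y ∈ V)
    (hXY : X = Y + t • k) (hX : T₁ * ‖X‖ ≤ |Ω X| * ‖u‖) : T₁ - T₀ * ‖k‖ ≤ |Ω k| := by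
  -- The orthogonal splitting $X=tu+Z$: `Z` lies in `V` and `u` is orthogonal to `V`.
  set Z := Y + t • (k - u)
  have hZ : Z ∈ V := V.add_mem hY (V.smul_mem t hku)
  have hXZ : X = t • u + Z := by
    simp only [hXY, Z, smul_sub]
    abel
  have hXn : ‖X‖ ^ 2 = t ^ 2 * ‖u‖ ^ 2 + ‖Z‖ ^ 2 := by
    have h := norm_add_sq_eq_norm_sq_add_norm_sq_of_inner_eq_zero (t • u) Z
      (by rw [inner_smul_left, hu Z hZ, mul_zero])
    rw [← hXZ, norm_smul, Real.norm_eq_abs] at h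
    nlinarith [sq_abs t]
  have hkn := norm_sq_eq_of_decomposition (hu _ hku)
  have hΩ : |Ω X| ≤ T₀ * ‖Z‖ + |t| * (T₀ * ‖k - u‖) + |t| * |Ω k| := by
    have e : Ω X = Ω Z - t * Ω (k - u) + t * Ω k := by
      simp only [hXY, Z, map_add, map_smul, smul_eq_mul]
      ring
    rw [e]
    refine (abs_add_le _ _).trans (add_le_add ((abs_sub _ _).trans ?_) (abs_mul _ _).le)
    rw [abs_mul]
    exact add_le_add (hV _ hZ) (mul_le_mul_of_nonneg_left (hV _ hku) (abs_nonneg t))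
  have hXpos : 0 < ‖X‖ := norm_pos_iff.2 hX0
  have htu : |t| * ‖u‖ ≤ ‖X‖ := by
    refine abs_le_of_sq_le_sq' ?_ hXpos.le |>.2
    rw [mul_pow, sq_abs, hXn]
    nlinarith [sq_nonneg ‖Z‖]
  -- Cauchy–Schwarz in the plane for $(\|u\|,\|k-u\|)$ and $(\|Z\|,|t|\|u\|)$, whose lengths are
  -- $\|k\|$ and $\|X\|$.
  have hcs : ‖u‖ * ‖Z‖ + |t| * ‖u‖ * ‖k - u‖ ≤ ‖k‖ * ‖X‖ := by
    refine abs_le_of_sq_le_sq' ?_ (by positivity) |>.2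
    rw [mul_pow, hXn, hkn]
    have : t ^ 2 = |t| ^ 2 := (sq_abs t).symm
    rw [this]
    nlinarith [sq_nonneg (‖u‖ * (|t| * ‖u‖) - ‖k - u‖ * ‖Z‖)]
  have key : T₁ * ‖X‖ ≤ (T₀ * ‖k‖ + |Ω k|) * ‖X‖ := by
    calc T₁ * ‖X‖ ≤ |Ω X| * ‖u‖ := hX
      _ ≤ (T₀ * ‖Z‖ + |t| * (T₀ * ‖k - u‖) + |t| * |Ω k|) * ‖u‖ := by gcongr
      _ = T₀ * (‖u‖ * ‖Z‖ + |t| * ‖u‖ * ‖k - u‖) + |Ω k| * (|t| * ‖u‖) := by ring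
      _ ≤ T₀ * (‖k‖ * ‖X‖) + |Ω k| * ‖X‖ := by gcongr
      _ = _ := by ring
  linarith [le_of_mul_le_mul_right key hXpos]

end Gram

/-! ### Lattices -/

/-- `toVec` as an additive map. -/
def toVecLM (d : ℕ) : FourierLattice d →ₗ[ℤ] Momentum d where
  toFun := toVec
  map_add' k l := by
    ext i
    simp [toVec_apply]
  map_smul' a k := by
    ext i
    simp [toVec_apply]

lemma toVecLM_apply (k : FourierLattice d) : toVecLM d k = toVec k := rfl

/-- The vectors of a lattice basis. -/
def basisVec {R : Sublattice d} {n : ℕ} (e : Module.Basis (Fin n) ℤ R) (i : Fin n) : Momentum d :=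
  toVec (e i : FourierLattice d)

/-- Two $\mathbb Z$-bases differ by a unimodular matrix `P`, and the Gram determinant changes by
$(\det P)^2=1$. The volume can thus be computed in a basis of short vectors or in an extended basis.
-/
lemma latticeVol_eq {R : Sublattice d} {n : ℕ} (e : Module.Basis (Fin n) ℤ R) :
    latticeVol R = Real.sqrt (Matrix.gram ℝ (basisVec e)).det := by
  obtain rfl : n = Module.finrank ℤ R := by
    rw [Module.finrank_eq_card_basis e, Fintype.card_fin]
  set b := Module.finBasis ℤ R
  have h1 : latticeVol R = Real.sqrt (Matrix.gram ℝ (basisVec b)).det := rfl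
  set P : Matrix _ _ ℝ := (b.toMatrix e).map (Int.cast : ℤ → ℝ)
  have h2 : ∀ j, basisVec e j = ∑ i, P i j • basisVec b i := by
    intro j
    have := congrArg (fun r : R => toVecLM d (r : FourierLattice d)) (b.sum_toMatrix_smul_self e j)
    simp only [Submodule.coe_sum, Submodule.coe_smul, map_sum, map_smul, toVecLM_apply] at this
    rw [basisVec, ← this]
    refine Finset.sum_congr rfl fun i _ => ?_
    simp only [P, Matrix.map_apply, Int.cast_smul_eq_zsmul]
    rfl
  have h3 : Matrix.gram ℝ (basisVec e) = P.transpose * Matrix.gram ℝ (basisVec b) * P := by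
    ext i j
    simp only [Matrix.gram_apply, h2, Matrix.mul_apply, Matrix.transpose_apply, sum_inner,
      inner_sum, inner_smul_left, inner_smul_right, Finset.sum_mul, Finset.mul_sum,
      conj_trivial]
    exact Finset.sum_congr rfl fun _ _ => Finset.sum_congr rfl fun _ _ => by ring
  have h4 : P.det ^ 2 = 1 := by
    have : P.det = ((b.toMatrix e).det : ℤ) := ((Int.castRingHom ℝ).map_det _).symm
    rw [this, ← Module.Basis.det_apply]
    rcases Int.isUnit_iff.1 (b.isUnit_det e) with h | h <;> simp [h]
  rw [h1, h3, Matrix.det_mul, Matrix.det_mul, Matrix.det_transpose]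
  congr 1
  linear_combination -(Matrix.gram ℝ (basisVec b)).det * h4

lemma inner_toVec (k l : FourierLattice d) :
    inner ℝ (toVec k) (toVec l) = ((∑ i, k i * l i : ℤ) : ℝ) := by
  simp [PiLp.inner_apply, toVec_apply, mul_comm]

/-- The Gram matrix is integral, so a vanishing determinant yields a nonzero integral kernel vector.
The corresponding combination of basis vectors has norm zero, against independence over $\mathbb Z$.
-/
lemma det_gram_basisVec_ne_zero {R : Sublattice d} {n : ℕ} (e : Module.Basis (Fin n) ℤ R) :
    (Matrix.gram ℝ (basisVec e)).det ≠ 0 := by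
  set G : Matrix (Fin n) (Fin n) ℤ := Matrix.of fun i j =>
    ∑ l, (e i : FourierLattice d) l * (e j : FourierLattice d) l
  have hG : Matrix.gram ℝ (basisVec e) = G.map (Int.castRingHom ℝ) := by
    ext i j
    simp only [Matrix.gram_apply, basisVec, inner_toVec, G, Matrix.map_apply, Matrix.of_apply,
      eq_intCast]
  rw [hG, ← RingHom.mapMatrix_apply, ← RingHom.map_det, eq_intCast, Int.cast_ne_zero]
  intro h0
  obtain ⟨w, hw0, hw⟩ := Matrix.exists_mulVec_eq_zero_iff.2 h0
  apply hw0
  have h1 : ∑ i, w i • (e i : FourierLattice d) = 0 := by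
    have hz : inner ℝ (toVec (∑ i, w i • (e i : FourierLattice d)))
        (toVec (∑ i, w i • (e i : FourierLattice d))) = (0 : ℝ) := by
      rw [inner_toVec, Int.cast_eq_zero]
      have : (∑ i, w i * (G.mulVec w) i) = 0 := by simp [hw]
      rw [← this]
      simp only [Finset.sum_apply, Pi.smul_apply, smul_eq_mul, Matrix.mulVec, dotProduct, G,
        Matrix.of_apply, Finset.mul_sum, Finset.sum_mul]
      rw [Finset.sum_comm]
      refine Finset.sum_congr rfl fun _ _ => ?_
      rw [Finset.sum_comm]
      exact Finset.sum_congr rfl fun _ _ => Finset.sum_congr rfl fun _ _ => by ring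
    rw [inner_self_eq_zero] at hz
    exact toVec_injective (hz.trans (by ext i; simp [toVec_apply]))
  have h2 : ∑ i, w i • e i = 0 := Subtype.ext (by simpa using h1)
  ext i
  exact Fintype.linearIndependent_iff.1 e.linearIndependent w h2 i

lemma latticeVol_pos {R : Sublattice d} {n : ℕ} (e : Module.Basis (Fin n) ℤ R) :
    0 < latticeVol R := by
  rw [latticeVol_eq e]
  exact Real.sqrt_pos.2 ((det_gram_nonneg _).lt_of_ne (det_gram_basisVec_ne_zero e).symm)

lemma latticeVol_le {R : Sublattice d} {n : ℕ} (e : Module.Basis (Fin n) ℤ R) {h : ℝ}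
    (hh : 0 ≤ h) (he : ∀ j, ‖toVec (e j : FourierLattice d)‖ ≤ h) : latticeVol R ≤ h ^ n := by
  rw [latticeVol_eq e]
  refine Real.sqrt_le_iff.2 ⟨pow_nonneg hh n, (det_gram_le _).trans ?_⟩
  rw [Finset.prod_pow]
  refine pow_le_pow_left₀ (Finset.prod_nonneg fun _ _ => norm_nonneg _) ?_ 2
  refine (Finset.prod_le_prod (fun _ _ => norm_nonneg _) fun j _ => he j).trans (by simp)

lemma realSpan_eq {R : Sublattice d} {n : ℕ} (e : Module.Basis (Fin n) ℤ R) :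
    realSpan R = Submodule.span ℝ (range (basisVec e)) := by
  refine le_antisymm (Submodule.span_le.2 ?_) (Submodule.span_mono ?_)
  · rintro _ ⟨k, hk, rfl⟩
    have h1 := congrArg (fun r : R => toVecLM d (r : FourierLattice d)) (e.sum_repr ⟨k, hk⟩)
    simp only [Submodule.coe_sum, Submodule.coe_smul, map_sum, map_smul, toVecLM_apply] at h1
    rw [SetLike.mem_coe, ← h1]
    refine Submodule.sum_mem _ fun i _ => ?_
    rw [← Int.cast_smul_eq_zsmul ℝ]
    exact Submodule.smul_mem _ _ (Submodule.subset_span ⟨i, rfl⟩)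
  · rintro _ ⟨i, rfl⟩
    exact ⟨_, (e i).2, rfl⟩

/-- The lattice generated by `R` and `k`. -/
def extend (R : Sublattice d) (k : FourierLattice d) : Sublattice d := R ⊔ Submodule.span ℤ {k}

lemma le_extend (R : Sublattice d) (k : FourierLattice d) : R ≤ extend R k := le_sup_left

lemma mem_extend {R : Sublattice d} {k z : FourierLattice d} :
    z ∈ extend R k ↔ ∃ y ∈ R, ∃ c : ℤ, z = y + c • k := by
  rw [extend, Submodule.mem_sup]
  simp only [Submodule.mem_span_singleton]
  constructor
  · rintro ⟨y, hy, _, ⟨c, rfl⟩, rfl⟩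
    exact ⟨y, hy, c, rfl⟩
  · rintro ⟨y, hy, c, rfl⟩
    exact ⟨y, hy, _, ⟨c, rfl⟩, rfl⟩

lemma mem_realSpan_extend {R : Sublattice d} {k : FourierLattice d} {X : Momentum d}
    (hX : X ∈ realSpan (extend R k)) : ∃ Y ∈ realSpan R, ∃ t : ℝ, X = Y + t • toVec k := by
  have h : realSpan (extend R k) ≤ realSpan R ⊔ Submodule.span ℝ {toVec k} := by
    refine Submodule.span_le.2 ?_
    rintro _ ⟨z, hz, rfl⟩
    obtain ⟨y, hy, c, rfl⟩ := mem_extend.1 hz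
    have : toVec (y + c • k) = toVec y + (c : ℝ) • toVec k := by
      ext i
      simp [toVec_apply]
    rw [this]
    exact Submodule.add_mem_sup (Submodule.subset_span ⟨y, hy, rfl⟩)
      (Submodule.smul_mem _ _ (Submodule.mem_span_singleton_self _))
  obtain ⟨Y, hY, W, hW, rfl⟩ := Submodule.mem_sup.1 (h hX)
  obtain ⟨t, rfl⟩ := Submodule.mem_span_singleton.1 hW
  exact ⟨Y, hY, t, rfl⟩

/-- The basis of the lattice generated by `R` and a vector outside the saturation of `R`. -/
def extendBasis {R : Sublattice d} {n : ℕ} (e : Module.Basis (Fin n) ℤ R) {k : FourierLattice d}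
    (hk : k ∉ saturation R) : Module.Basis (Fin (n + 1)) ℤ (extend R k) :=
  Module.Basis.mkFinConsOfLE k (mem_extend.2 ⟨0, R.zero_mem, 1, by simp⟩) e (le_extend R k)
    -- A nonzero multiple of `k` in `R` would be orthogonal to the annihilator of `R`, and then so
    -- would `k`.
    (fun c x hx hcx => by
      by_contra hc
      refine hk fun n hn => ?_
      have h1 := hn x hx
      have h2 : x = -(c • k) := by
        rw [← add_eq_zero_iff_eq_neg, add_comm]
        exact hcx
      rw [h2] at h1
      simp only [Pi.neg_apply, Pi.smul_apply, smul_eq_mul, neg_mul, Finset.sum_neg_distrib,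
        mul_assoc, ← Finset.mul_sum, neg_eq_zero, mul_eq_zero, hc, false_or] at h1
      simpa only [mul_comm] using h1)
    (fun z hz => by
      obtain ⟨y, hy, c, rfl⟩ := mem_extend.1 hz
      exact ⟨-c, by simpa using hy⟩)

lemma basisVec_extendBasis {R : Sublattice d} {n : ℕ} (e : Module.Basis (Fin n) ℤ R)
    {k : FourierLattice d} (hk : k ∉ saturation R) :
    basisVec (extendBasis e hk) = (Fin.cons (toVec k) (basisVec e) : Fin (n + 1) → Momentum d) := by
  ext1 i
  rw [basisVec, extendBasis, Module.Basis.coe_mkFinConsOfLE]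
  refine Fin.cases ?_ (fun i => ?_) i <;> simp [basisVec]

/-- Vectors of the saturation lie in the real span. -/
lemma toVec_mem_realSpan {R : Sublattice d} {k : FourierLattice d} (hk : k ∈ saturation R) :
    toVec k ∈ realSpan R := by
  let ι : FourierLattice d → Fin d → ℚ := fun k i => (k i : ℚ)
  set W : Submodule ℚ (Fin d → ℚ) := Submodule.span ℚ (ι '' (R : Set (FourierLattice d)))
  have hW : ι k ∈ W := by
    by_contra hkW
    -- A rational functional separating `k` from the rational span becomes, after clearing
    -- denominators, an integer vector in the annihilator of `R` not orthogonal to `k`.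
    obtain ⟨f, hf, hker⟩ := Submodule.exists_le_ker_of_notMem hkW
    obtain ⟨b, hb⟩ := IsLocalization.exist_integer_multiples_of_finite (nonZeroDivisors ℤ)
      fun i => f (Pi.single i (1 : ℚ))
    choose n hn using hb
    have hsum : ∀ l : FourierLattice d, ((∑ i, l i * n i : ℤ) : ℚ) = ((b : ℤ) : ℚ) * f (ι l) := by
      intro l
      have : ι l = ∑ i, (l i : ℚ) • (Pi.single i (1 : ℚ) : Fin d → ℚ) := by
        ext j
        simp [ι, Pi.single_apply]
      rw [this, map_sum, Finset.mul_sum, Int.cast_sum]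
      refine Finset.sum_congr rfl fun i _ => ?_
      have h1 : (n i : ℚ) = ((b : ℤ) : ℚ) * f (Pi.single i (1 : ℚ)) := by
        simpa [Algebra.smul_def] using hn i
      rw [Int.cast_mul, h1, map_smul, smul_eq_mul]
      ring
    have hmem : n ∈ annihilatorLattice R := fun l hl => by
      have h0 : f (ι l) = 0 := hker (Submodule.subset_span ⟨l, hl, rfl⟩)
      have := hsum l
      rw [h0, mul_zero] at this
      exact_mod_cast this
    have h0 : ∑ i, k i * n i = 0 := by simpa only [mul_comm] using hk n hmem
    have h1 := hsum k
    rw [h0, Int.cast_zero, eq_comm, mul_eq_zero] at h1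
    rcases h1 with h1 | h1
    · exact nonZeroDivisors.coe_ne_zero b (by exact_mod_cast h1)
    · exact hf h1
  have hind : ∀ v ∈ W, (WithLp.toLp 2 fun i => ((v i : ℚ) : ℝ) : Momentum d) ∈ realSpan R := by
    intro v hv
    induction hv using Submodule.span_induction with
    | mem v hv =>
      obtain ⟨l, hl, rfl⟩ := hv
      refine Submodule.subset_span ⟨l, hl, ?_⟩
      ext i
      simp [ι, toVec_apply]
    | zero =>
      convert (realSpan R).zero_mem using 1
      ext i
      simp
    | add v w _ _ hv hw =>
      convert (realSpan R).add_mem hv hw using 1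
      ext i
      simp
    | smul q v _ hv =>
      convert (realSpan R).smul_mem (q : ℝ) hv using 1
      ext i
      simp
  convert hind _ hW using 1
  ext i
  simp [ι, toVec_apply]

variable {d : ℕ}

/-! ### Frequencies in resonance blocks -/

section Blocks

variable {H : Momentum d → ℝ} {γ δ ħ : ℝ} {R : Sublattice d} {k : FourierLattice d}
  {ξ : Momentum d}

lemma Omega_eq_zero_of_mem_saturation (hξ : ξ ∈ resonanceManifold H R) (hk : k ∈ saturation R) :
    Omega H (toVec k) ξ = 0 := by
  have h : realSpan R ≤ LinearMap.ker (fderiv ℝ H ξ : Momentum d →ₗ[ℝ] ℝ) := by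
    refine Submodule.span_le.2 ?_
    rintro _ ⟨l, hl, rfl⟩
    exact hξ l hl
  exact h (toVec_mem_realSpan hk)

/-- In the block of `R`, frequencies outside the saturation of `R` are far from resonant. -/
lemma le_abs_Omega_of_mem_resonanceBlock (hħ : ħ ∈ Ioc (0 : ℝ) 1)
    (hR : IsResonanceLattice γ ħ R) (hk : k ∉ saturation R) (hkγ : ‖toVec k‖ ≤ ħ ^ (-γ))
    (hξ : ξ ∈ resonanceBlock H γ δ ħ R) :
    2 * (‖toVec k‖ * ħ ^ δ) ≤ |Omega H (toVec k) ξ| := by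
  obtain ⟨n, e, he⟩ := hR
  have hn : Module.finrank ℤ R = n := by rw [Module.finrank_eq_card_basis e, Fintype.card_fin]
  have hn' : Module.finrank ℤ (extend R k) = n + 1 := by
    rw [Module.finrank_eq_card_basis (extendBasis e hk), Fintype.card_fin]
  have hres : IsResonanceLattice γ ħ (extend R k) := by
    refine ⟨n + 1, extendBasis e hk, fun j => ?_⟩
    have : toVec (extendBasis e hk j : FourierLattice d) =
      (Fin.cons (toVec k) (basisVec e) : Fin (n + 1) → Momentum d) j :=
      congrFun (basisVec_extendBasis e hk) j
    rw [this]
    refine Fin.cases ?_ (fun i => ?_) j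
    · simpa using hkγ
    · simpa [basisVec] using he i
  obtain ⟨hξ1, hξ2⟩ := hξ
  -- The block excludes the zone of the extended lattice, so some direction `X` in its real span has
  -- a large frequency.
  have hout : ξ ∉ resonanceZone H γ δ ħ (extend R k) := fun h =>
    hξ2 ⟨_, hres, by rw [hn', hn], h⟩
  simp only [resonanceZone, mem_ofPred_eq, hn'] at hout
  push Not at hout
  obtain ⟨X, hXmem, hX0, hX⟩ := hout
  simp only [resonanceZone, mem_ofPred_eq, hn] at hξ1
  obtain ⟨u, hku, hu⟩ := exists_orthogonal_decomposition (basisVec e) (toVec k)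
  have hvol : latticeVol (extend R k) = ‖u‖ * latticeVol R := by
    rw [latticeVol_eq (extendBasis e hk), basisVec_extendBasis, latticeVol_eq e,
      det_gram_cons _ _ u hku fun j => hu _ (Submodule.subset_span ⟨j, rfl⟩),
      Real.sqrt_mul (sq_nonneg _), Real.sqrt_sq (norm_nonneg _)]
  have hv := latticeVol_pos e
  have hupos : 0 < ‖u‖ := by
    have := latticeVol_pos (extendBasis e hk)
    rw [hvol] at this
    exact pos_of_mul_pos_left this hv.le
  rw [← realSpan_eq] at hku hu
  set h := ħ ^ (-γ)
  have hh : 0 < h := Real.rpow_pos_of_pos hħ.1 _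
  have hδ := Real.rpow_pos_of_pos hħ.1 δ
  set T := 2 ^ n * ħ ^ (δ - γ * n) / latticeVol R
  have hpow : ħ ^ (δ - γ * n) = ħ ^ δ * h ^ n := by
    rw [← Real.rpow_natCast h, ← Real.rpow_mul hħ.1.le, ← Real.rpow_add hħ.1]
    congr 1
    ring
  have hpow' : ħ ^ (δ - γ * ((n + 1 : ℕ) : ℝ)) = ħ ^ (δ - γ * n) * h := by
    rw [← Real.rpow_add hħ.1]
    congr 1
    push_cast
    ring
  have hTpos : 0 < T := div_pos (mul_pos (by positivity) (Real.rpow_pos_of_pos hħ.1 _)) hv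
  -- Hadamard's inequality $\mathrm{vol}(\mathcal R)\le h^n$ cancels the factor $\hbar^{-\gamma n}$
  -- in the zone width.
  have hT : 2 ^ n * ħ ^ δ ≤ T := by
    rw [le_div_iff₀ hv, hpow, ← mul_assoc]
    have := latticeVol_le e hh.le he
    gcongr
  -- The volume of the extended lattice contributes $1/\|u\|$, and the next zone is wider by $2h$
  -- apart from this factor.
  have hXu : 2 * T * h * ‖X‖ ≤ |(fderiv ℝ H ξ : Momentum d →ₗ[ℝ] ℝ) X| * ‖u‖ := by
    have hXpos : 0 < ‖X‖ := norm_pos_iff.2 hX0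
    rw [le_div_iff₀ hXpos, hvol, hpow'] at hX
    have : 2 * T * h * ‖X‖ =
        2 ^ (n + 1) * (ħ ^ (δ - γ * n) * h) / (‖u‖ * latticeVol R) * ‖X‖ * ‖u‖ := by
      simp only [T]
      field_simp
      ring
    rw [this]
    exact mul_le_mul_of_nonneg_right hX hupos.le
  obtain ⟨Y, hY, t, hXY⟩ := mem_realSpan_extend hXmem
  have key : ∀ T₀ : ℝ, 0 ≤ T₀ → (∀ y ∈ realSpan R, |fderiv ℝ H ξ y| ≤ T₀ * ‖y‖) →
      2 * T * h - T₀ * h ≤ |Omega H (toVec k) ξ| := fun T₀ hT₀ hy => by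
    have := lower_bound_of_large_on_span (realSpan R) (fderiv ℝ H ξ : Momentum d →ₗ[ℝ] ℝ)
      hku hu hT₀ hy hX0 hY hXY hXu
    refine le_trans ?_ this
    gcongr
  -- For $n\ge1$ the choice $T_0=T$ leaves $Th$, and $2^n\ge2$ gives the factor $2$. For $n=0$ that
  -- factor is missing, but the real span is zero, so $T_0=0$ leaves the whole $2Th$.
  rcases Nat.eq_zero_or_pos n with h0 | h0
  · subst h0
    have h1 := key 0 le_rfl fun y hy => by
      rw [realSpan_eq e, range_eq_empty, Submodule.span_empty, Submodule.mem_bot] at hy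
      simp [hy]
    rw [pow_zero, one_mul] at hT
    calc 2 * (‖toVec k‖ * ħ ^ δ) ≤ 2 * (h * T) := by gcongr
      _ ≤ _ := by linarith
  · have h1 := key T hTpos.le fun y hy => by
      by_cases hy0 : y = 0
      · simp [hy0]
      · exact ((div_lt_iff₀ (norm_pos_iff.2 hy0)).1 (hξ1 y hy hy0)).le
    have h2 : (2 : ℝ) ≤ 2 ^ n := le_self_pow₀ one_le_two h0.ne'
    calc 2 * (‖toVec k‖ * ħ ^ δ) ≤ h * (2 ^ n * ħ ^ δ) := by
          have := mul_le_mul hkγ h2 two_pos.le hh.le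
          nlinarith
      _ ≤ h * T := by gcongr
      _ ≤ _ := by linarith

/-- The differential of $H$ is Lipschitz, so the shift changes it by $O(\hbar|k|)$; pairing with $k$
and dividing by $|k|\hbar^\delta$ leaves $|k|\hbar^{1-\delta}$. -/
lemma HasBoundedDerivs.exists_abs_phase_sub_le (hH : HasBoundedDerivs H) (δ : ℝ) :
    ∃ C : ℝ, 0 < C ∧ ∀ ħ ∈ Ioc (0 : ℝ) 1, ∀ s ∈ Icc (0 : ℝ) 1, ∀ (k : FourierLattice d) ξ,
      |phase H δ s ħ k ξ - Omega H (toVec k) ξ / (‖toVec k‖ * ħ ^ δ)| ≤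
        C * weight k * ħ ^ (1 - δ) := by
  obtain ⟨C, hC⟩ := hH.bound 2
  have hC0 : 0 ≤ C := (norm_nonneg _).trans (hC 0)
  refine ⟨C + 1, by positivity, fun ħ hħ s hs k ξ => ?_⟩
  have hħδ := Real.rpow_pos_of_pos hħ.1 δ
  have hd : ContDiff ℝ ∞ (fderiv ℝ H) := hH.smooth.fderiv_right (by exact_mod_cast le_top)
  have hlip := Convex.norm_image_sub_le_of_norm_fderiv_le (𝕜 := ℝ) (f := fderiv ℝ H)
    (s := univ) (C := C) (x := ξ) (y := ξ + (s * ħ) • toVec k)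
    (fun y _ => hd.differentiable (by simp) y)
    (fun y _ => by
      rw [← norm_iteratedFDeriv_one, norm_iteratedFDeriv_fderiv]
      exact hC y)
    convex_univ (mem_univ _) (mem_univ _)
  rw [add_sub_cancel_left, norm_smul, Real.norm_of_nonneg (mul_nonneg hs.1 hħ.1.le)] at hlip
  have hw := weight_pos k
  have hħ1 : ħ ^ (1 - δ) = ħ * (ħ ^ δ)⁻¹ := by
    rw [sub_eq_add_neg, Real.rpow_add hħ.1, Real.rpow_one, Real.rpow_neg hħ.1.le]
  have h1 : |Omega H (toVec k) (ξ + (s * ħ) • toVec k) - Omega H (toVec k) ξ| ≤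
      (C + 1) * (ħ * weight k) * ‖toVec k‖ := by
    have h2 : Omega H (toVec k) (ξ + (s * ħ) • toVec k) - Omega H (toVec k) ξ =
        (fderiv ℝ H (ξ + (s * ħ) • toVec k) - fderiv ℝ H ξ) (toVec k) := rfl
    rw [h2, ← Real.norm_eq_abs]
    refine (ContinuousLinearMap.le_opNorm _ _).trans ?_
    gcongr
    refine hlip.trans ?_
    have hs1 : s * ħ ≤ ħ := mul_le_of_le_one_left hħ.1.le hs.2
    have hkw := norm_toVec_le_weight k
    have hħ0 := hħ.1.le
    have hC1 : C ≤ C + 1 := by linarith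
    have hs0 := hs.1
    gcongr
  rw [phase, ← sub_div, abs_div, abs_of_nonneg (by positivity : 0 ≤ ‖toVec k‖ * ħ ^ δ)]
  refine div_le_of_le_mul₀ (by positivity) (by have := hħ.1; positivity) (h1.trans (le_of_eq ?_))
  rw [hħ1]
  field_simp

/-- In the block of `R`, the phases of the frequencies outside the saturation of `R` are large,
up to high frequencies and large `ħ`. -/
lemma HasBoundedDerivs.exists_phase_large (hH : HasBoundedDerivs H) (hγ : 0 < γ) (hδ : δ < 1) :
    ∃ A ε : ℝ, 0 < A ∧ 0 < ε ∧ ∀ ħ ∈ Ioc (0 : ℝ) 1, ∀ s ∈ Icc (0 : ℝ) 1,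
      ∀ (R : Sublattice d), IsResonanceLattice γ ħ R → ∀ k ∉ saturation R,
      ∀ ξ ∈ resonanceBlock H γ δ ħ R,
      1 < |phase H δ s ħ k ξ| ∨ 1 ≤ A * weight k * ħ ^ ε := by
  obtain ⟨C, hC, hCb⟩ := hH.exists_abs_phase_sub_le δ
  -- The exponent $\gamma$ handles frequencies beyond $\hbar^{-\gamma}$, and $1-\delta$ the error of
  -- the shift for the others.
  refine ⟨C + 1, min γ (1 - δ), by positivity, lt_min hγ (by linarith),
    fun ħ hħ s hs R hR k hk ξ hξ => ?_⟩
  have hw := weight_pos k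
  have hmin : ∀ x, min γ (1 - δ) ≤ x → ħ ^ x ≤ ħ ^ min γ (1 - δ) := fun x hx =>
    Real.rpow_le_rpow_of_exponent_ge hħ.1 hħ.2 hx
  have hεpos := Real.rpow_pos_of_pos hħ.1 (min γ (1 - δ))
  rcases le_or_gt ‖toVec k‖ (ħ ^ (-γ)) with hkγ | hkγ
  · by_cases hbig : 1 ≤ (C + 1) * weight k * ħ ^ min γ (1 - δ)
    · exact Or.inr hbig
    left
    have h1 := le_abs_Omega_of_mem_resonanceBlock (H := H) (δ := δ) hħ hR hk hkγ hξ
    have hk0 : k ≠ 0 := fun h => hk (by rw [h]; exact (saturation R).zero_mem)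
    have hpos : 0 < ‖toVec k‖ * ħ ^ δ :=
      mul_pos (norm_pos_iff.2 (toVec_ne_zero hk0)) (Real.rpow_pos_of_pos hħ.1 _)
    have h2 : 2 ≤ |Omega H (toVec k) ξ / (‖toVec k‖ * ħ ^ δ)| := by
      rw [abs_div, abs_of_pos hpos, le_div_iff₀ hpos]
      exact h1
    have h3 := hCb ħ hħ s hs k ξ
    -- The unshifted quotient is at least $2$, so a shift error below $1$ keeps the phase above $1$.
    have h4 : C * weight k * ħ ^ (1 - δ) < 1 := by
      refine lt_of_le_of_lt ?_ (not_le.1 hbig)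
      have := hmin _ (min_le_right _ _)
      have hC1 : C ≤ C + 1 := by linarith
      have hpow := (Real.rpow_pos_of_pos hħ.1 (1 - δ)).le
      gcongr
    have h5 := abs_sub_abs_le_abs_sub (Omega H (toVec k) ξ / (‖toVec k‖ * ħ ^ δ))
      (phase H δ s ħ k ξ)
    rw [abs_sub_comm] at h5
    linarith
  · right
    have h1 : 1 ≤ weight k * ħ ^ γ := by
      have : 1 = ħ ^ (-γ) * ħ ^ γ := by rw [← Real.rpow_add hħ.1]; simp
      rw [this]
      have h0 := (Real.rpow_pos_of_pos hħ.1 γ).le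
      have := hkγ.le.trans (norm_toVec_le_weight k)
      gcongr
    calc 1 ≤ weight k * ħ ^ γ := h1
      _ ≤ weight k * ħ ^ min γ (1 - δ) := by
          have := hmin _ (min_le_left _ _)
          gcongr
      _ ≤ (C + 1) * (weight k * ħ ^ min γ (1 - δ)) :=
          le_mul_of_one_le_left (by positivity) (by linarith)
      _ = _ := by ring

end Blocks

/-! ### The multipliers of the quasi-average -/

/-- The multipliers `χ(Ω_k(ξ + s ħ k) / (|k| ħ^δ))` for `k ≠ 0`, and `1` for `k = 0`. -/
def cutoff (H : Momentum d → ℝ) (χ : ℝ → ℝ) (δ s : ℝ) :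
    ℝ → FourierLattice d → Momentum d → ℂ :=
  fun ħ k ξ => if k = 0 then 1 else ((χ (phase H δ s ħ k ξ) : ℝ) : ℂ)

/-- The multipliers of the difference with the lattice average of the symbol. -/
def defectMultiplier (R : ℝ → Sublattice d) (c : ℝ → FourierLattice d → Momentum d → ℂ) :
    ℝ → FourierLattice d → Momentum d → ℂ :=
  fun ħ k ξ => c ħ k ξ - restrictMultiplier R (fun _ _ _ => 1) ħ k ξ

/-- The multipliers of the difference with the own lattice average. -/
def selfDefectMultiplier (R : ℝ → Sublattice d) (c : ℝ → FourierLattice d → Momentum d → ℂ) :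
    ℝ → FourierLattice d → Momentum d → ℂ :=
  fun ħ k ξ => c ħ k ξ - restrictMultiplier R c ħ k ξ

/-! ### Sums, multiples and restrictions of multipliers. -/

section Bounds

variable {M δ : ℝ} {S : ℝ → Set (Momentum d)} {c c' : ℝ → FourierLattice d → Momentum d → ℂ}

/-- Two bounds for multipliers given by a case distinction on `ħ` and `k`. -/
lemma MultiplierBound.of_or
    (h : ∀ b : ℕ, ∃ (C C' : ℝ) (p p' : ℕ), 0 < C ∧ 0 < C' ∧
      ∀ ħ ∈ Ioc (0 : ℝ) 1, ∀ k, ∀ ξ ∈ S ħ,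
      ‖iteratedFDeriv ℝ b (c ħ k) ξ‖ ≤ C * weight k ^ p * ħ ^ (M - δ * b) ∨
      ‖iteratedFDeriv ℝ b (c ħ k) ξ‖ ≤ C' * weight k ^ p' * ħ ^ (M - δ * b)) :
    MultiplierBound δ M S c := fun b => by
  obtain ⟨C, C', p, p', hC, hC', hb⟩ := h b
  refine ⟨C + C', p + p', by positivity, fun ħ hħ k ξ hξ => ?_⟩
  have hħ' := (Real.rpow_pos_of_pos hħ.1 (M - δ * b)).le
  have hw := one_le_weight k
  rcases hb ħ hħ k ξ hξ with h | h
  · refine h.trans ?_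
    gcongr ?_ * ?_ * _
    · linarith
    · exact pow_le_pow_right₀ hw (by omega)
  · refine h.trans ?_
    gcongr ?_ * ?_ * _
    · linarith
    · exact pow_le_pow_right₀ hw (by omega)

lemma MultiplierBound.add (hc : ∀ ħ ∈ Ioc (0 : ℝ) 1, ∀ k, ContDiff ℝ ∞ (c ħ k))
    (hc' : ∀ ħ ∈ Ioc (0 : ℝ) 1, ∀ k, ContDiff ℝ ∞ (c' ħ k))
    (h : MultiplierBound δ M S c) (h' : MultiplierBound δ M S c') :
    MultiplierBound δ M S fun ħ k ξ => c ħ k ξ + c' ħ k ξ := fun b => by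
  obtain ⟨C, p, hC, hb⟩ := h b
  obtain ⟨C', p', hC', hb'⟩ := h' b
  refine ⟨C + C', p + p', by positivity, fun ħ hħ k ξ hξ => ?_⟩
  have hħ' := (Real.rpow_pos_of_pos hħ.1 (M - δ * b)).le
  have hw := one_le_weight k
  have e : iteratedFDeriv ℝ b (fun ξ => c ħ k ξ + c' ħ k ξ) ξ =
      iteratedFDeriv ℝ b (c ħ k) ξ + iteratedFDeriv ℝ b (c' ħ k) ξ :=
    iteratedFDeriv_add_apply ((hc ħ hħ k).contDiffAt.of_le (by exact_mod_cast le_top))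
      ((hc' ħ hħ k).contDiffAt.of_le (by exact_mod_cast le_top))
  rw [e, add_mul, add_mul]
  refine (norm_add_le _ _).trans (add_le_add ((hb ħ hħ k ξ hξ).trans ?_)
    ((hb' ħ hħ k ξ hξ).trans ?_))
  · gcongr
    omega
  · gcongr
    omega

lemma MultiplierBound.const_mul (hc : ∀ ħ ∈ Ioc (0 : ℝ) 1, ∀ k, ContDiff ℝ ∞ (c ħ k))
    (h : MultiplierBound δ M S c) (a : ℂ) :
    MultiplierBound δ M S fun ħ k ξ => a * c ħ k ξ := fun b => by
  obtain ⟨C, p, hC, hb⟩ := h b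
  refine ⟨(‖a‖ + 1) * C, p, by positivity, fun ħ hħ k ξ hξ => ?_⟩
  have e : iteratedFDeriv ℝ b (fun ξ => a * c ħ k ξ) ξ = a • iteratedFDeriv ℝ b (c ħ k) ξ :=
    iteratedFDeriv_const_smul_apply (a := a)
      ((hc ħ hħ k).contDiffAt.of_le (by exact_mod_cast le_top))
  rw [e, norm_smul, mul_assoc, mul_assoc, ← mul_assoc C]
  exact mul_le_mul (by linarith) (hb ħ hħ k ξ hξ) (norm_nonneg _) (by positivity)

lemma IsMultiplier.add (hc : IsMultiplier δ c) (hc' : IsMultiplier δ c') :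
    IsMultiplier δ fun ħ k ξ => c ħ k ξ + c' ħ k ξ :=
  ⟨fun ħ hħ k => (hc.smooth ħ hħ k).add (hc'.smooth ħ hħ k),
    hc.bound.add hc.smooth hc'.smooth hc'.bound⟩

lemma IsMultiplier.const_mul (hc : IsMultiplier δ c) (a : ℂ) :
    IsMultiplier δ fun ħ k ξ => a * c ħ k ξ :=
  ⟨fun ħ hħ k => contDiff_const.mul (hc.smooth ħ hħ k), hc.bound.const_mul hc.smooth a⟩

lemma IsMultiplier.sub (hc : IsMultiplier δ c) (hc' : IsMultiplier δ c') :
    IsMultiplier δ fun ħ k ξ => c ħ k ξ - c' ħ k ξ := by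
  simpa [sub_eq_add_neg] using hc.add (hc'.const_mul (-1))

lemma norm_iteratedFDeriv_const_le {E F : Type*} [NormedAddCommGroup E] [NormedSpace ℝ E]
    [NormedAddCommGroup F] [NormedSpace ℝ F] (v : F) (n : ℕ) (x : E) :
    ‖iteratedFDeriv ℝ n (fun _ : E => v) x‖ ≤ ‖v‖ := by
  rcases Nat.eq_zero_or_pos n with rfl | hn
  · simp
  · rw [iteratedFDeriv_const_of_ne hn.ne']
    simp

lemma isMultiplier_one (hδ : 0 < δ) : IsMultiplier (d := d) δ fun _ _ _ => 1 := by
  refine ⟨fun _ _ _ => contDiff_const, fun b => ⟨1, 0, one_pos, fun ħ hħ k ξ _ => ?_⟩⟩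
  have h1 : 1 ≤ ħ ^ (0 - δ * b) :=
    Real.one_le_rpow_of_pos_of_le_one_of_nonpos hħ.1 hħ.2 (by
      have := mul_nonneg hδ.le b.cast_nonneg
      linarith)
  have := norm_iteratedFDeriv_const_le (1 : ℂ) b ξ
  rw [norm_one] at this
  linarith

lemma IsMultiplier.restrict (hc : IsMultiplier δ c) (R : ℝ → Sublattice d) :
    IsMultiplier δ (restrictMultiplier R c) := by
  classical
  have h : ∀ ħ k, restrictMultiplier R c ħ k = if k ∈ saturation (R ħ) then c ħ k else 0 :=
    fun ħ k => by
      ext ξ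
      simp only [restrictMultiplier]
      split_ifs <;> rfl
  refine ⟨fun ħ hħ k => ?_, fun b => ?_⟩
  · rw [h]
    split_ifs
    · exact hc.smooth ħ hħ k
    · exact contDiff_const
  · obtain ⟨C, p, hC, hb⟩ := hc.bound b
    refine ⟨C, p, hC, fun ħ hħ k ξ hξ => ?_⟩
    rw [h]
    split_ifs
    · exact hb ħ hħ k ξ hξ
    · have := Real.rpow_pos_of_pos hħ.1 (0 - δ * b)
      have := weight_pos k
      exact (norm_iteratedFDeriv_const_le (0 : ℂ) b ξ).trans (by rw [norm_zero]; positivity)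

end Bounds

/-- Multipliers for which the multiplied symbol is a quasi-resonant average. -/
structure IsAveragingMultiplier (H : Momentum d → ℝ) (γ δ : ℝ)
    (c : ℝ → FourierLattice d → Momentum d → ℂ) : Prop where
  isMultiplier : IsMultiplier δ c
  defect : ∀ R : ℝ → Sublattice d, (∀ ħ ∈ Ioc (0 : ℝ) 1, IsResonanceLattice γ ħ (R ħ)) → ∀ M,
    MultiplierBound δ M
      (fun ħ => resonanceManifold H (R ħ) ∩ resonanceBlock H γ δ ħ (R ħ)) (defectMultiplier R c)
  selfDefect : ∀ R : ℝ → Sublattice d, (∀ ħ ∈ Ioc (0 : ℝ) 1, IsResonanceLattice γ ħ (R ħ)) →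
    ∀ M, MultiplierBound δ M (fun ħ => resonanceBlock H γ δ ħ (R ħ)) (selfDefectMultiplier R c)

/-! ### Averaging multipliers and the cutoffs. -/

section Averaging

variable {H : Momentum d → ℝ} {γ δ m : ℝ} {χ : ℝ → ℝ}
  {c c' : ℝ → FourierLattice d → Momentum d → ℂ} {K A : Family d}

lemma IsMultiplier.defectMultiplier (hc : IsMultiplier δ c) (hδ : 0 < δ)
    (R : ℝ → Sublattice d) : IsMultiplier δ (defectMultiplier R c) :=
  hc.sub ((isMultiplier_one hδ).restrict R)

lemma IsMultiplier.selfDefectMultiplier (hc : IsMultiplier δ c) (R : ℝ → Sublattice d) :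
    IsMultiplier δ (selfDefectMultiplier R c) :=
  hc.sub (hc.restrict R)

/-- By self-adjointness `K` is its own Fourier series, with multiplier $1$. Both differences are
then multiplier symbols, with the two defects as multipliers. -/
theorem IsAveragingMultiplier.hasAveragingProperties (hc : IsAveragingMultiplier H γ δ c)
    (hδ : 0 < δ) (hK : IsGlobalSymbol m δ K) (hKsa : IsSelfAdjointSymbol K)
    (hA : ∀ ħ ∈ Ioc (0 : ℝ) 1, ∀ x ξ, A ħ x ξ = multiplierSymbol c K ħ x ξ) :
    HasAveragingProperties H γ δ m K A := by
  have hA' : ∀ ħ ∈ Ioc (0 : ℝ) 1, A ħ = multiplierSymbol c K ħ := fun ħ hħ => by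
    ext x ξ
    exact hA ħ hħ x ξ
  have hm := hc.isMultiplier
  have h1 := isMultiplier_one (d := d) hδ
  refine ⟨(hm.isGlobalSymbol hK).congr fun ħ hħ x ξ => (hA ħ hħ x ξ).symm,
    fun R hR => ⟨fun M => ?_, fun M => ?_⟩⟩
  · refine ((hm.defectMultiplier hδ R).isNegligibleOn (hc.defect R hR) hK M).congr
      fun ħ hħ x ξ => ?_
    have hK1 : K ħ = multiplierSymbol (fun _ _ _ => 1) K ħ := by
      ext x ξ
      exact hKsa.eq_multiplierSymbol hK hħ x ξ
    rw [hA ħ hħ, hK1, h1.latticeAverage_multiplierSymbol hK hħ]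
    exact multiplierSymbol_sub hm (h1.restrict R) hK hħ x ξ
  · refine ((hm.selfDefectMultiplier R).isNegligibleOn (hc.selfDefect R hR) hK M).congr
      fun ħ hħ x ξ => ?_
    rw [hA' ħ hħ, hm.latticeAverage_multiplierSymbol hK hħ]
    exact multiplierSymbol_sub hm (hm.restrict R) hK hħ x ξ

/-- The weights of the mean sum to $1$, so the defect of the mean is the mean of the defects. -/
lemma IsAveragingMultiplier.half_add (hδ : 0 < δ) (hc : IsAveragingMultiplier H γ δ c)
    (hc' : IsAveragingMultiplier H γ δ c') :
    IsAveragingMultiplier H γ δ fun ħ k ξ => (1 / 2 : ℂ) * (c ħ k ξ + c' ħ k ξ) where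
  isMultiplier := (hc.isMultiplier.add hc'.isMultiplier).const_mul _
  defect R hR M := by
    have h := hc.isMultiplier.defectMultiplier hδ R
    have h' := hc'.isMultiplier.defectMultiplier hδ R
    convert ((hc.defect R hR M).add h.smooth h'.smooth (hc'.defect R hR M)).const_mul
      (fun ħ hħ k => (h.smooth ħ hħ k).add (h'.smooth ħ hħ k)) (1 / 2) using 1
    ext ħ k ξ
    simp only [defectMultiplier]
    ring
  selfDefect R hR M := by
    have h := hc.isMultiplier.selfDefectMultiplier R
    have h' := hc'.isMultiplier.selfDefectMultiplier R
    convert ((hc.selfDefect R hR M).add h.smooth h'.smooth (hc'.selfDefect R hR M)).const_mul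
      (fun ħ hħ k => (h.smooth ħ hħ k).add (h'.smooth ħ hħ k)) (1 / 2) using 1
    ext ħ k ξ
    simp only [selfDefectMultiplier, restrictMultiplier]
    split_ifs <;> ring

lemma cutoff_zero (s ħ : ℝ) : cutoff H χ δ s ħ 0 = fun _ => 1 := by
  ext ξ
  simp [cutoff]

lemma cutoff_of_ne {k : FourierLattice d} (hk : k ≠ 0) (s ħ : ℝ) :
    cutoff H χ δ s ħ k = fun ξ => ((χ (phase H δ s ħ k ξ) : ℝ) : ℂ) := by
  ext ξ
  simp [cutoff, hk]

lemma contDiff_comp_phase (hχ : IsTruncation χ) (hH : HasBoundedDerivs H) (s ħ : ℝ)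
    (k : FourierLattice d) : ContDiff ℝ ∞ fun ξ => χ (phase H δ s ħ k ξ) :=
  hχ.smooth.comp (hH.contDiff_phase δ s ħ k)

lemma isMultiplier_cutoff (hχ : IsTruncation χ) (hH : HasBoundedDerivs H) (hδ : 0 < δ) (s : ℝ) :
    IsMultiplier δ (cutoff H χ δ s) := by
  refine ⟨fun ħ hħ k => ?_, MultiplierBound.of_or fun b => ?_⟩
  · by_cases hk : k = 0
    · rw [hk, cutoff_zero]
      exact contDiff_const
    · rw [cutoff_of_ne hk]
      exact Complex.ofRealCLM.contDiff.comp (contDiff_comp_phase hχ hH s ħ k)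
  · obtain ⟨C, hC, hCb⟩ := hχ.exists_norm_comp_phase_le hH hδ b
    obtain ⟨C', p', hC', hCb'⟩ := (isMultiplier_one (d := d) hδ).bound b
    refine ⟨C, C', 0, p', hC, hC', fun ħ hħ k ξ _ => ?_⟩
    by_cases hk : k = 0
    · right
      rw [hk, cutoff_zero]
      exact hCb' ħ hħ 0 ξ trivial
    · left
      rw [cutoff_of_ne hk, norm_iteratedFDeriv_ofReal (contDiff_comp_phase hχ hH s ħ k)]
      simpa using hCb ħ hħ s k ξ

lemma defectMultiplier_of_notMem {R : ℝ → Sublattice d} {ħ : ℝ} {k : FourierLattice d}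
    (hk : k ∉ saturation (R ħ)) : defectMultiplier R c ħ k = c ħ k := by
  ext ξ
  simp [defectMultiplier, restrictMultiplier, hk]

lemma defectMultiplier_of_mem {R : ℝ → Sublattice d} {ħ : ℝ} {k : FourierLattice d}
    (hk : k ∈ saturation (R ħ)) : defectMultiplier R c ħ k = fun ξ => c ħ k ξ - 1 := by
  ext ξ
  simp [defectMultiplier, restrictMultiplier, hk]

lemma selfDefectMultiplier_of_notMem {R : ℝ → Sublattice d} {ħ : ℝ} {k : FourierLattice d}
    (hk : k ∉ saturation (R ħ)) : selfDefectMultiplier R c ħ k = c ħ k := by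
  ext ξ
  simp [selfDefectMultiplier, restrictMultiplier, hk]

lemma selfDefectMultiplier_of_mem {R : ℝ → Sublattice d} {ħ : ℝ} {k : FourierLattice d}
    (hk : k ∈ saturation (R ħ)) : selfDefectMultiplier R c ħ k = 0 := by
  ext ξ
  simp [selfDefectMultiplier, restrictMultiplier, hk]

/-- Outside the saturation the truncation is negligible over the block. -/
lemma exists_norm_cutoff_le (hχ : IsTruncation χ) (hH : HasBoundedDerivs H) (hγ : 0 < γ)
    (hδ : 0 < δ) (hδ1 : δ < 1) {s : ℝ} (hs : s ∈ Icc (0 : ℝ) 1) (M : ℝ) (b : ℕ) :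
    ∃ (C : ℝ) (p : ℕ), 0 < C ∧ ∀ ħ ∈ Ioc (0 : ℝ) 1, ∀ R : Sublattice d,
      IsResonanceLattice γ ħ R → ∀ k ∉ saturation R, ∀ ξ ∈ resonanceBlock H γ δ ħ R,
      ‖iteratedFDeriv ℝ b (cutoff H χ δ s ħ k) ξ‖ ≤ C * weight k ^ p * ħ ^ (M - δ * b) := by
  obtain ⟨A, ε, hA, hε, hlarge⟩ := hH.exists_phase_large (γ := γ) hγ hδ1
  obtain ⟨C, p, hC, hCb⟩ := hχ.exists_norm_comp_phase_le_of_large hH hδ hA hε M b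
  refine ⟨C, p, hC, fun ħ hħ R hR k hk ξ hξ => ?_⟩
  have hk0 : k ≠ 0 := fun h => hk (by rw [h]; exact (saturation R).zero_mem)
  rw [cutoff_of_ne hk0, norm_iteratedFDeriv_ofReal (contDiff_comp_phase hχ hH s ħ k)]
  exact hCb ħ hħ s k ξ (hlarge ħ hħ s hs R hR k hk ξ hξ)

lemma isAveragingMultiplier_cutoff (hχ : IsTruncation χ) (hH : HasBoundedDerivs H) (hγ : 0 < γ)
    (hδ : 0 < δ) (hδ1 : δ < 1) {s : ℝ} (hs : s ∈ Icc (0 : ℝ) 1) :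
    IsAveragingMultiplier H γ δ (cutoff H χ δ s) where
  isMultiplier := isMultiplier_cutoff hχ hH hδ s
  defect R hR M := MultiplierBound.of_or fun b => by
    obtain ⟨C, p, hC, hCb⟩ := exists_norm_cutoff_le hχ hH hγ hδ hδ1 hs M b
    obtain ⟨A, hA, hAb⟩ := hH.exists_abs_phase_sub_le δ
    obtain ⟨C', p', hC', hCb'⟩ := hχ.exists_norm_comp_phase_sub_one_le_of_small hH hδ hA
      (sub_pos.2 hδ1) M b
    refine ⟨C, C', p, p', hC, hC', fun ħ hħ k ξ hξ => ?_⟩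
    by_cases hk : k ∈ saturation (R ħ)
    · right
      rw [defectMultiplier_of_mem hk]
      by_cases hk0 : k = 0
      · have := Real.rpow_pos_of_pos hħ.1 (M - δ * b)
        have := weight_pos k
        have hz : (fun ξ => cutoff H χ δ s ħ k ξ - 1) = 0 := by
          rw [hk0, cutoff_zero]
          ext ξ
          simp
        rw [hz]
        exact (norm_iteratedFDeriv_const_le (0 : ℂ) b ξ).trans (by rw [norm_zero]; positivity)
      · have h1 := hAb ħ hħ s hs k ξ
        -- Over $\Sigma_{\mathcal R}$ only the shift error of the phase remains, so flatness of
        -- $\chi-1$ applies.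
        rw [Omega_eq_zero_of_mem_saturation hξ.1 hk, zero_div, sub_zero] at h1
        have h2 : (fun ξ => cutoff H χ δ s ħ k ξ - 1) =
            fun ξ => ((χ (phase H δ s ħ k ξ) - 1 : ℝ) : ℂ) := by
          rw [cutoff_of_ne hk0]
          ext ξ
          simp
        rw [h2, norm_iteratedFDeriv_ofReal ((contDiff_comp_phase hχ hH s ħ k).sub contDiff_const)]
        exact hCb' ħ hħ s k ξ h1
    · left
      rw [defectMultiplier_of_notMem hk]
      exact hCb ħ hħ (R ħ) (hR ħ hħ) k hk ξ hξ.2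
  selfDefect R hR M b := by
    obtain ⟨C, p, hC, hCb⟩ := exists_norm_cutoff_le hχ hH hγ hδ hδ1 hs M b
    refine ⟨C, p, hC, fun ħ hħ k ξ hξ => ?_⟩
    by_cases hk : k ∈ saturation (R ħ)
    · have := Real.rpow_pos_of_pos hħ.1 (M - δ * b)
      have := weight_pos k
      rw [selfDefectMultiplier_of_mem hk]
      exact (norm_iteratedFDeriv_const_le (0 : ℂ) b ξ).trans (by rw [norm_zero]; positivity)
    · rw [selfDefectMultiplier_of_notMem hk]
      exact hCb ħ hħ (R ħ) (hR ħ hħ) k hk ξ hξ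

lemma quasiAverage_eq_multiplierSymbol :
    quasiAverage H χ δ K = multiplierSymbol (cutoff H χ δ 0) K := by
  ext ħ x ξ
  simp [quasiAverage, multiplierSymbol, cutoff, phase]

/-- Passing to $-k$ changes the sign of the phase, which the even function $\chi$ ignores, and the
values are real. The only trace of the adjoint is the shift of the momentum by $\hbar k$. -/
lemma adjointMultiplier_cutoff (hχ : IsTruncation χ) :
    adjointMultiplier (cutoff H χ δ 0) = cutoff (d := d) H χ δ 1 := by
  ext ħ k ξ
  by_cases hk : k = 0
  · simp [adjointMultiplier, cutoff, hk]
  · have h : phase H δ 0 ħ (-k) (ξ + ħ • toVec k) = -phase H δ 1 ħ k ξ := by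
      simp [phase, Omega, toVec_neg, neg_div]
    simp [adjointMultiplier, cutoff, hk, h, hχ.even]

lemma adjointSymbol_quasiAverage (hχ : IsTruncation χ) (hH : HasBoundedDerivs H) (hδ : 0 < δ)
    (hK : IsGlobalSymbol m δ K) (hKsa : IsSelfAdjointSymbol K) {ħ : ℝ} (hħ : ħ ∈ Ioc (0 : ℝ) 1)
    (x : Fin d → ℝ) (ξ : Momentum d) :
    adjointSymbol (quasiAverage H χ δ K) ħ x ξ = multiplierSymbol (cutoff H χ δ 1) K ħ x ξ := by
  rw [quasiAverage_eq_multiplierSymbol,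
    (isMultiplier_cutoff hχ hH hδ 0).adjointSymbol_multiplierSymbol hK hKsa hħ,
    adjointMultiplier_cutoff hχ]

lemma selfAdjointPart_quasiAverage (hχ : IsTruncation χ) (hH : HasBoundedDerivs H) (hδ : 0 < δ)
    (hK : IsGlobalSymbol m δ K) (hKsa : IsSelfAdjointSymbol K) {ħ : ℝ} (hħ : ħ ∈ Ioc (0 : ℝ) 1)
    (x : Fin d → ℝ) (ξ : Momentum d) :
    selfAdjointPart (quasiAverage H χ δ K) ħ x ξ = multiplierSymbol
      (fun ħ k ξ => (1 / 2 : ℂ) * (cutoff H χ δ 0 ħ k ξ + cutoff H χ δ 1 ħ k ξ)) K ħ x ξ := by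
  rw [multiplierSymbol_const_mul, multiplierSymbol_add (isMultiplier_cutoff hχ hH hδ 0)
    (isMultiplier_cutoff hχ hH hδ 1) hK hħ, selfAdjointPart,
    adjointSymbol_quasiAverage hχ hH hδ hK hKsa hħ, quasiAverage_eq_multiplierSymbol]

end Averaging

end TorusPDO

end

theorem mainTheorem6 (d : ℕ) (γ δ m : ℝ) (hγ : 0 < γ) (hδ : 0 < δ) (hγδ : γ + δ < 1)
    (H : TorusPDO.Momentum d → ℝ)
    (hH : TorusPDO.IsGlobalSymbol 0 0 (fun _ _ ξ => ((H ξ : ℝ) : ℂ) : TorusPDO.Family d))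
    (χ : ℝ → ℝ) (hχ : TorusPDO.IsTruncation χ)
    (K : TorusPDO.Family d) (hK : TorusPDO.IsGlobalSymbol m δ K)
    (hKsa : TorusPDO.IsSelfAdjointSymbol K) :
    TorusPDO.HasAveragingProperties H γ δ m K
      (TorusPDO.adjointSymbol (TorusPDO.quasiAverage H χ δ K)) ∧
    TorusPDO.HasAveragingProperties H γ δ m K
      (TorusPDO.selfAdjointPart (TorusPDO.quasiAverage H χ δ K)) := by
  have hH' := TorusPDO.hasBoundedDerivs_of_isGlobalSymbol hH
  have hδ1 : δ < 1 := by linarith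
  have h0 := TorusPDO.isAveragingMultiplier_cutoff hχ hH' hγ hδ hδ1 (s := 0) (by simp)
  have h1 := TorusPDO.isAveragingMultiplier_cutoff hχ hH' hγ hδ hδ1 (s := 1) (by simp)
  exact ⟨h1.hasAveragingProperties hδ hK hKsa fun ħ hħ x ξ =>
      TorusPDO.adjointSymbol_quasiAverage hχ hH' hδ hK hKsa hħ x ξ,
    (h0.half_add hδ h1).hasAveragingProperties hδ hK hKsa fun ħ hħ x ξ =>
      TorusPDO.selfAdjointPart_quasiAverage hχ hH' hδ hK hKsa hħ x ξ⟩
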